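/- **Conventions.** Spacetimes are 4-dimensional, with signature $(-,+,+,+)$. The Riemann tensor is fixed by $\nabla_a\nabla_b v_c-\nabla_b\nabla_a v_c=R_{abcd}v^d$, the Ricci tensor is $R_{bd}=g^{ac}R_{abcd}$, the Schouten tensor is $P_{ab}=\tfrac12R_{ab}-\tfrac{R}{12}g_{ab}$ with trace $J=R/6$, the Weyl tensor $C_{abcd}$ is given by $R_{abcd}=C_{abcd}+g_{ca}P_{bd}-g_{cb}P_{ad}+g_{db}P_{ac}-g_{da}P_{bc}$, the Cotton tensor is $A_{abc}=\nabla_bP_{ca}-\nabla_cP_{ba}$, and the Bach tensor is $B_{ab}=-\nabla^cA_{abc}+P^{dc}C_{dacb}$. **Theorem.** Let $\overline{\mathcal M}$ be a smooth 4-manifold with boundary, with interior $\check{\mathcal M}$ and boundary $\mathcal I^-=\partial\overline{\mathcal M}$. Let $\bar g$ be a smooth Lorentzian metric on $\overline{\mathcal M}$, $\check g$ a smooth Lorentzian metric on $\check{\mathcal M}$, and $\omega$ a smooth function on $\overline{\mathcal M}$, positive on $\check{\mathcal M}$, with $\bar g=\omega^{-2}\check g$ on $\check{\mathcal M}$. Let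 $S_{ab}$ and $\overline T_{ab}$ be smooth tensor fields on $\overline{\mathcal M}$, and let $\check\Lambda>0$ and $v\ge 0$ be constants. Suppose that, with the curvature and the wave operator of $\bar g$, $$\overline B_{ab}=S_{ab}\ \text{ on } \overline{\mathcal M},\qquad \overline\Box\,\omega=\overline J\,\omega-\tfrac23\,\omega^3\check\Lambda+\tfrac16\,\overline T\,\omega^{1-v}\ \text{ on }\check{\mathcal M},\qquad \overline T=\bar g^{ab}\overline T_{ab},$$ and that $\omega=0$ and $\bar g^{ab}\overline\nabla_a\omega\overline\nabla_b\omega=-1$ on $\mathcal I^-$ (so $\mathcal I^-$ is the zero locus of $\omega$). Then the hypersurface $\mathcal I^-$ is spacelike. Moreover, let $\bar n^a$ be a (local) smooth unit normal of $\mathcal I^-$, $\bar n^a\bar n_a=-1$ (either choice), let $\overline h_{ab}=\bar g_{ab}+\bar n_a\bar n_b$ be the induced metric with Levi-Civita connection $\overline D_a$, let $\overline K_{ab}=\overline h_a{}^c\,\overline\nabla_c\bar n_b$ be the extrinsic curvature, let an index $\bar\perp$ denote contraction with $\bar n^a$ and $\top$ projection of the remaining indices to $\mathcal I^-$, and let $E_{ab}=C_{\bar\perp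 a\bar\perp b}$ be the electric part of the Weyl tensor of $\bar g$. Then on $\mathcal I^-$ $$S_{\bar\perp\bar\perp}=\overline D^a\overline D^bE_{ab}-\overline D^c\big(C^{\top}_{cab\bar\perp}\overline K^{ab}\big)+\overline P^{\top}_{ab}E^{ab}+\overline K^{ab}\,\overline A^{\top}_{a\bar\perp b},$$ $$S^{\top}_{a\bar\perp}=-\overline D^b\overline A^{\top}_{a\bar\perp b}-\big(\overline D^bE_{cb}\big)\overline K_a{}^c+\overline K_a{}^d\,\overline K^{bc}\,C_{\bar\perp bcd}+\overline P^{\top\,cd}\,C^{\top}_{dac\bar\perp}+\overline P^{\top}_{\bar\perp b}\,E_a{}^b .$$ -/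

import Mathlib

open scoped Manifold ContDiff
open Set

noncomputable section

namespace BachConstraint

/-- Coordinate space `ℝⁿ`. -/
abbrev Coord (n : ℕ) : Type := EuclideanSpace ℝ (Fin n)

/-! ### Tensor calculus in coordinates

All functions below live on a set `s ⊆ ℝⁿ` (the coordinate domain), which for a boundary chart is a
relatively open subset of a closed half-space; partial derivatives are taken within `s`, so they are
one-sided at boundary points. Tensors are given by their components with lower indices. -/

/-- The partial derivative `∂ᵢ f` within `s`. -/
def pd {n : ℕ} (s : Set (Coord n)) (i : Fin n) (f : Coord n → ℝ) (x : Coord n) : ℝ :=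
  fderivWithin ℝ f s x (EuclideanSpace.single i 1)

/-- The Christoffel symbols `Γᵏᵢⱼ` of the Levi-Civita connection of `g`. -/
def christoffel {n : ℕ} (s : Set (Coord n)) (g : Coord n → Matrix (Fin n) (Fin n) ℝ)
    (x : Coord n) (k i j : Fin n) : ℝ :=
  (1 / 2) * ∑ l, (g x)⁻¹ k l *
    (pd s i (fun y => g y l j) x + pd s j (fun y => g y l i) x - pd s l (fun y => g y i j) x)

/-- The covariant derivative `∇ₖ tₐ` of a covector. -/
def cov1 {n : ℕ} (s : Set (Coord n)) (g : Coord n → Matrix (Fin n) (Fin n) ℝ)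
    (t : Coord n → Fin n → ℝ) (x : Coord n) (k a : Fin n) : ℝ :=
  pd s k (fun y => t y a) x - ∑ l, christoffel s g x l k a * t x l

/-- The covariant derivative `∇ₖ tₐᵦ`. -/
def cov2 {n : ℕ} (s : Set (Coord n)) (g : Coord n → Matrix (Fin n) (Fin n) ℝ)
    (t : Coord n → Fin n → Fin n → ℝ) (x : Coord n) (k a b : Fin n) : ℝ :=
  pd s k (fun y => t y a b) x - ∑ l, christoffel s g x l k a * t x l b
    - ∑ l, christoffel s g x l k b * t x a l

/-- The covariant derivative `∇ₖ tₐᵦ꜀`. -/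
def cov3 {n : ℕ} (s : Set (Coord n)) (g : Coord n → Matrix (Fin n) (Fin n) ℝ)
    (t : Coord n → Fin n → Fin n → Fin n → ℝ) (x : Coord n) (k a b c : Fin n) : ℝ :=
  pd s k (fun y => t y a b c) x - ∑ l, christoffel s g x l k a * t x l b c
    - ∑ l, christoffel s g x l k b * t x a l c - ∑ l, christoffel s g x l k c * t x a b l

/-- The trace `gᵃᵇ tₐᵦ` of a tensor `t` at a point where the metric has matrix `G`. -/
def tr {n : ℕ} (G : Matrix (Fin n) (Fin n) ℝ) (t : Fin n → Fin n → ℝ) : ℝ :=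
  ∑ a, ∑ b, G⁻¹ a b * t a b

/-- The full contraction `tᵃᵇ rₐᵦ = gᵃᶜ gᵇᵈ t꜀ᵈ rₐᵦ` at a point where the metric has matrix `G`. -/
def contr {n : ℕ} (G : Matrix (Fin n) (Fin n) ℝ) (t r : Fin n → Fin n → ℝ) : ℝ :=
  ∑ a, ∑ b, ∑ c, ∑ d, G⁻¹ a c * G⁻¹ b d * t c d * r a b

/-- The wave operator (Laplace-Beltrami operator) `□f = gᵃᵇ ∇ₐ∇ᵦ f`. -/
def box {n : ℕ} (s : Set (Coord n)) (g : Coord n → Matrix (Fin n) (Fin n) ℝ)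
    (f : Coord n → ℝ) (x : Coord n) : ℝ :=
  tr (g x) fun a b => cov1 s g (fun y c => pd s c f y) x a b

/-! ### Curvature in dimension four -/

/-- The Riemann tensor `Rₐᵦ꜀ᵈ` (all indices lowered), with the sign convention
`∇ₐ∇ᵦ v꜀ - ∇ᵦ∇ₐ v꜀ = Rₐᵦ꜀ᵈ vᵈ`. -/
def riemann (s : Set (Coord 4)) (g : Coord 4 → Matrix (Fin 4) (Fin 4) ℝ) (x : Coord 4)
    (a b c d : Fin 4) : ℝ :=
  ∑ e, g x e d *
    (pd s b (fun y => christoffel s g y e a c) x - pd s a (fun y => christoffel s g y e b c) x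
      + ∑ f, (christoffel s g x f a c * christoffel s g x e b f
          - christoffel s g x f b c * christoffel s g x e a f))

/-- The Ricci tensor `Rᵦᵈ = gᵃᶜ Rₐᵦ꜀ᵈ`. -/
def ricci (s : Set (Coord 4)) (g : Coord 4 → Matrix (Fin 4) (Fin 4) ℝ) (x : Coord 4)
    (b d : Fin 4) : ℝ :=
  tr (g x) fun a c => riemann s g x a b c d

/-- The scalar curvature. -/
def scalar (s : Set (Coord 4)) (g : Coord 4 → Matrix (Fin 4) (Fin 4) ℝ) (x : Coord 4) : ℝ :=
  tr (g x) (ricci s g x)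

/-- The Schouten tensor `Pₐᵦ = Rₐᵦ / 2 - (R / 12) gₐᵦ`. -/
def schouten (s : Set (Coord 4)) (g : Coord 4 → Matrix (Fin 4) (Fin 4) ℝ) (x : Coord 4)
    (a b : Fin 4) : ℝ :=
  (1 / 2) * ricci s g x a b - scalar s g x / 12 * g x a b

/-- The trace `J = gᵃᵇ Pₐᵦ` of the Schouten tensor. -/
def schoutenTrace (s : Set (Coord 4)) (g : Coord 4 → Matrix (Fin 4) (Fin 4) ℝ) (x : Coord 4) : ℝ :=
  tr (g x) (schouten s g x)

/-- The Weyl tensor, defined by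
`Rₐᵦ꜀ᵈ = Cₐᵦ꜀ᵈ + g꜀ₐ Pᵦᵈ - g꜀ᵦ Pₐᵈ + gᵈᵦ Pₐ꜀ - gᵈₐ Pᵦ꜀`. -/
def weyl (s : Set (Coord 4)) (g : Coord 4 → Matrix (Fin 4) (Fin 4) ℝ) (x : Coord 4)
    (a b c d : Fin 4) : ℝ :=
  riemann s g x a b c d
    - (g x c a * schouten s g x b d - g x c b * schouten s g x a d
      + g x d b * schouten s g x a c - g x d a * schouten s g x b c)

/-- The Cotton tensor `Aₐᵦ꜀ = ∇ᵦ P꜀ₐ - ∇꜀ Pᵦₐ`. -/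
def cotton (s : Set (Coord 4)) (g : Coord 4 → Matrix (Fin 4) (Fin 4) ℝ) (x : Coord 4)
    (a b c : Fin 4) : ℝ :=
  cov2 s g (schouten s g) x b c a - cov2 s g (schouten s g) x c b a

/-- The Bach tensor `Bₐᵦ = - ∇ᶜ Aₐᵦ꜀ + Pᵈᶜ Cᵈₐ꜀ᵦ`. -/
def bach (s : Set (Coord 4)) (g : Coord 4 → Matrix (Fin 4) (Fin 4) ℝ) (x : Coord 4)
    (a b : Fin 4) : ℝ :=
  - tr (g x) (fun k c => cov3 s g (cotton s g) x k a b c)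
    + contr (g x) (schouten s g x) (fun d c => weyl s g x d a c b)

/-! ### Local parametrizations of hypersurfaces

A piece of a hypersurface is given by a map `φ : ℝ³ ⊇ V → s ⊆ ℝ⁴`, that is, by local coordinates on
the hypersurface; tensors on the hypersurface are given by their components in these coordinates,
obtained from the spacetime tensors by inserting the tangent vectors `∂ᵢφ` (the projection `⊤`) or
the unit normal `N` (the contraction `⊥`). -/

/-- The components of the coordinate tangent vector `∂ᵢφ`. -/
def tang (V : Set (Coord 3)) (φ : Coord 3 → Coord 4) (u : Coord 3) (i : Fin 3) (a : Fin 4) : ℝ :=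
  pd V i (fun w => φ w a) u

/-- `t(X)` for a covector `t`. -/
def ev1 (t : Fin 4 → ℝ) (X : Fin 4 → ℝ) : ℝ := ∑ a, t a * X a

/-- `t(X, Y)` for a tensor `t`. -/
def ev2 (t : Fin 4 → Fin 4 → ℝ) (X Y : Fin 4 → ℝ) : ℝ := ev1 (fun a => ev1 (t a) Y) X

/-- `t(X, Y, Z)` for a tensor `t`. -/
def ev3 (t : Fin 4 → Fin 4 → Fin 4 → ℝ) (X Y Z : Fin 4 → ℝ) : ℝ := ev1 (fun a => ev2 (t a) Y Z) X

/-- `t(X, Y, Z, W)` for a tensor `t`. -/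
def ev4 (t : Fin 4 → Fin 4 → Fin 4 → Fin 4 → ℝ) (X Y Z W : Fin 4 → ℝ) : ℝ :=
  ev1 (fun a => ev3 (t a) Y Z W) X

/-- The induced metric `hᵢⱼ = g(∂ᵢφ, ∂ⱼφ)`. -/
def indMetric (g : Coord 4 → Matrix (Fin 4) (Fin 4) ℝ) (V : Set (Coord 3)) (φ : Coord 3 → Coord 4)
    (u : Coord 3) : Matrix (Fin 3) (Fin 3) ℝ :=
  Matrix.of fun i j => ev2 (g (φ u)) (tang V φ u i) (tang V φ u j)

/-- `φ` is a local parametrization (a smooth immersion), defined on the open set `V`, of the zero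
locus of the function `f` inside the coordinate domain `s`. -/
structure IsLocalParam (s : Set (Coord 4)) (f : Coord 4 → ℝ) (V : Set (Coord 3))
    (φ : Coord 3 → Coord 4) : Prop where
  isOpen : IsOpen V
  contDiffOn : ContDiffOn ℝ ∞ φ V
  mapsTo : ∀ u ∈ V, φ u ∈ s ∧ f (φ u) = 0
  immersion : ∀ u ∈ V, LinearIndependent ℝ (tang V φ u)

/-- `N` is a smooth timelike unit normal, `g(N, N) = -1`, along the parametrized hypersurface `φ`. -/
structure IsUnitNormal (g : Coord 4 → Matrix (Fin 4) (Fin 4) ℝ) (V : Set (Coord 3))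
    (φ : Coord 3 → Coord 4) (N : Coord 3 → Fin 4 → ℝ) : Prop where
  contDiffOn : ContDiffOn ℝ ∞ N V
  unit : ∀ u ∈ V, ev2 (g (φ u)) (N u) (N u) = -1
  normal : ∀ u ∈ V, ∀ i, ev2 (g (φ u)) (N u) (tang V φ u i) = 0

/-- The extrinsic curvature `Kᵢⱼ = g(∇_{∂ᵢφ} N, ∂ⱼφ)`, the tangential part of `∇ₐ n_b`; here
`∇_{∂ᵢφ} N = ∂ᵢ Nᵃ + Γᵃ_{cd} (∂ᵢφ)ᶜ Nᵈ` is the covariant derivative along the hypersurface. -/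
def extrinsic (s : Set (Coord 4)) (g : Coord 4 → Matrix (Fin 4) (Fin 4) ℝ) (V : Set (Coord 3))
    (φ : Coord 3 → Coord 4) (N : Coord 3 → Fin 4 → ℝ) (u : Coord 3) (i j : Fin 3) : ℝ :=
  ev2 (g (φ u))
    (fun a => pd V i (fun w => N w a) u
      + ∑ c, ∑ d, christoffel s g (φ u) a c d * tang V φ u i c * N u d)
    (tang V φ u j)

/-- The electric part `Eᵢⱼ = C_{⊥ i ⊥ j}` of the Weyl tensor. -/
def electric (s : Set (Coord 4)) (g : Coord 4 → Matrix (Fin 4) (Fin 4) ℝ) (V : Set (Coord 3))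
    (φ : Coord 3 → Coord 4) (N : Coord 3 → Fin 4 → ℝ) (u : Coord 3) (i j : Fin 3) : ℝ :=
  ev4 (weyl s g (φ u)) (N u) (tang V φ u i) (N u) (tang V φ u j)

/-- The part `C^⊤_{ijk⊥}` of the Weyl tensor. -/
def weylTTTN (s : Set (Coord 4)) (g : Coord 4 → Matrix (Fin 4) (Fin 4) ℝ) (V : Set (Coord 3))
    (φ : Coord 3 → Coord 4) (N : Coord 3 → Fin 4 → ℝ) (u : Coord 3) (i j k : Fin 3) : ℝ :=
  ev4 (weyl s g (φ u)) (tang V φ u i) (tang V φ u j) (tang V φ u k) (N u)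

/-- The part `C_{⊥ijk}` of the Weyl tensor. -/
def weylNTTT (s : Set (Coord 4)) (g : Coord 4 → Matrix (Fin 4) (Fin 4) ℝ) (V : Set (Coord 3))
    (φ : Coord 3 → Coord 4) (N : Coord 3 → Fin 4 → ℝ) (u : Coord 3) (i j k : Fin 3) : ℝ :=
  ev4 (weyl s g (φ u)) (N u) (tang V φ u i) (tang V φ u j) (tang V φ u k)

/-- The part `A^⊤_{i⊥j}` of the Cotton tensor. -/
def cottonTNT (s : Set (Coord 4)) (g : Coord 4 → Matrix (Fin 4) (Fin 4) ℝ) (V : Set (Coord 3))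
    (φ : Coord 3 → Coord 4) (N : Coord 3 → Fin 4 → ℝ) (u : Coord 3) (i j : Fin 3) : ℝ :=
  ev3 (cotton s g (φ u)) (tang V φ u i) (N u) (tang V φ u j)

/-- The part `P^⊤_{ij}` of the Schouten tensor. -/
def schoutenTT (s : Set (Coord 4)) (g : Coord 4 → Matrix (Fin 4) (Fin 4) ℝ) (V : Set (Coord 3))
    (φ : Coord 3 → Coord 4) (u : Coord 3) (i j : Fin 3) : ℝ :=
  ev2 (schouten s g (φ u)) (tang V φ u i) (tang V φ u j)

/-- The part `P^⊤_{⊥i}` of the Schouten tensor. -/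
def schoutenNT (s : Set (Coord 4)) (g : Coord 4 → Matrix (Fin 4) (Fin 4) ℝ) (V : Set (Coord 3))
    (φ : Coord 3 → Coord 4) (N : Coord 3 → Fin 4 → ℝ) (u : Coord 3) (i : Fin 3) : ℝ :=
  ev2 (schouten s g (φ u)) (N u) (tang V φ u i)

/-- The intrinsic divergence `Dᵇ tᵦ`, where `D` is the Levi-Civita connection of `h`. -/
def div1 (V : Set (Coord 3)) (h : Coord 3 → Matrix (Fin 3) (Fin 3) ℝ)
    (t : Coord 3 → Fin 3 → ℝ) (u : Coord 3) : ℝ :=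
  tr (h u) (cov1 V h t u)

/-- The intrinsic divergence `Dᵇ tₐᵦ` on the second index. -/
def div2 (V : Set (Coord 3)) (h : Coord 3 → Matrix (Fin 3) (Fin 3) ℝ)
    (t : Coord 3 → Fin 3 → Fin 3 → ℝ) (u : Coord 3) (a : Fin 3) : ℝ :=
  tr (h u) fun k b => cov2 V h t u k a b

/-! ### Tensor fields on a four-manifold with boundary -/

section Manifold

variable {M : Type*} [TopologicalSpace M] [ChartedSpace (EuclideanHalfSpace 4) M]

/-- A (not necessarily smooth) field of bilinear forms on the tangent spaces, i.e. a tensor field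
with two lower indices. -/
abbrev TensorField2 (M : Type*) [TopologicalSpace M] [ChartedSpace (EuclideanHalfSpace 4) M] :
    Type _ :=
  ∀ p : M, LinearMap.BilinForm ℝ (TangentSpace (𝓡∂ 4) p)

/-- The coordinate domain of a chart, a relatively open subset of the closed half-space. -/
abbrev dom (e : OpenPartialHomeomorph M (EuclideanHalfSpace 4)) : Set (Coord 4) :=
  (e.extend (𝓡∂ 4)).target

/-- The point of the manifold with given coordinates. -/
abbrev pt (e : OpenPartialHomeomorph M (EuclideanHalfSpace 4)) (y : Coord 4) : M :=
  (e.extend (𝓡∂ 4)).symm y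

/-- The coordinate vector field `∂ᵢ` of a chart. -/
def coordVec (e : OpenPartialHomeomorph M (EuclideanHalfSpace 4)) (y : Coord 4) (i : Fin 4) :
    TangentSpace (𝓡∂ 4) (pt e y) :=
  mfderivWithin 𝓘(ℝ, Coord 4) (𝓡∂ 4) (e.extend (𝓡∂ 4)).symm (dom e) y (EuclideanSpace.single i 1)

/-- The components of a tensor field in a chart. -/
def comp (e : OpenPartialHomeomorph M (EuclideanHalfSpace 4)) (T : TensorField2 M) (y : Coord 4) :
    Matrix (Fin 4) (Fin 4) ℝ :=
  Matrix.of fun i j => T (pt e y) (coordVec e y i) (coordVec e y j)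

/-- A tensor field is smooth on `U` if its components in all smooth charts are. -/
def IsSmoothOn (U : Set M) (T : TensorField2 M) : Prop :=
  ∀ e ∈ IsManifold.maximalAtlas (𝓡∂ 4) ∞ M, ∀ i j,
    ContDiffOn ℝ ∞ (fun y => comp e T y i j) (dom e ∩ pt e ⁻¹' U)

/-- A smooth Lorentzian metric on `U`, of signature `(-, +, +, +)`. -/
structure IsLorentzMetricOn (U : Set M) (g : TensorField2 M) : Prop where
  smooth : IsSmoothOn U g
  signature : ∀ p ∈ U, ∃ b : Module.Basis (Fin 4) ℝ (TangentSpace (𝓡∂ 4) p),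
    ∀ i j, g p (b i) (b j) = if i = j then (if i = 0 then -1 else 1) else 0

/-- The manifold with boundary `M`, with the metric `gbar`, is a conformal extension of the spacetime
that consists of the interior of `M` with the metric `gcheck`: the function `w`, smooth on `M`, is
positive in the interior, where `gbar = w⁻² gcheck`, and `gbar` is regular up to the boundary. -/
structure IsConformalExtension (gbar gcheck : TensorField2 M) (w : M → ℝ) : Prop where
  lorentz_bar : IsLorentzMetricOn univ gbar
  lorentz_check : IsLorentzMetricOn ((𝓡∂ 4).interior M) gcheck
  smooth : ContMDiff (𝓡∂ 4) 𝓘(ℝ) ∞ w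
  pos : ∀ p ∈ (𝓡∂ 4).interior M, 0 < w p
  conformal : ∀ p ∈ (𝓡∂ 4).interior M, gbar p = (w p ^ 2)⁻¹ • gcheck p

/-- The regular conformal field equations: `B̄ₐᵦ = Sₐᵦ` on the conformal extension, and
`□̄ w = J̄ w - (2/3) Λ w³ + (1/6) T̄ w^(1-v)` where `w` is positive, with `T̄ = ḡᵃᵇ T̄ₐᵦ`. -/
structure ConformalFieldEquations (gbar S Tbar : TensorField2 M) (w : M → ℝ) (Λ v : ℝ) : Prop where
  bach_eq : ∀ e ∈ IsManifold.maximalAtlas (𝓡∂ 4) ∞ M, ∀ y ∈ dom e, ∀ a b,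
    bach (dom e) (comp e gbar) y a b = comp e S y a b
  wave_eq : ∀ e ∈ IsManifold.maximalAtlas (𝓡∂ 4) ∞ M, ∀ y ∈ dom e, 0 < w (pt e y) →
    box (dom e) (comp e gbar) (fun z => w (pt e z)) y
      = schoutenTrace (dom e) (comp e gbar) y * w (pt e y) - (2 / 3) * w (pt e y) ^ 3 * Λ
        + (1 / 6) * tr (comp e gbar y) (comp e Tbar y) * w (pt e y) ^ (1 - v)

end Manifold

end BachConstraint

end

/-! The two formulas are identities for the Bach tensor of any metric along a parametrized
hypersurface with a unit normal of square -1 and a nondegenerate induced metric (`IsSpacelike`). The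
field equation then puts S in place of B.

Spacelikeness comes from the gradient condition. The function ω vanishes along the hypersurface, so
its differential annihilates the tangent vectors. A covector of square -1 has a spacelike kernel, by
Cauchy-Schwarz in an orthonormal frame (`IsLorentzMatrix.pos_of_covector`, `posDef_indMetric`).
Hence h is positive definite, and (N, ∂ᵢφ) is a frame with g⁻¹ = h⁻¹ - N⊗N.

The components of B with one normal argument contain no derivative transverse to the hypersurface
beyond those inside A, C and P. Indeed the normal part of ∇ᶜA_{ab c}, contracted with N in b, has N
in both antisymmetric slots of A and vanishes. What remains are derivatives of A along the
hypersurface. By the Gauss and Weingarten formulas (`gauss`, `weingarten`) these are intrinsic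
derivatives of the components of A plus products of K with A (`div_cotton_normal`,
`div_cotton_tang`).

The component A_{⊥⊥j} occurs there but not in the result. It is removed through the dimension-four
identity ∇ᵃC_{abcd} = A_{bcd} (`div_weyl`), a consequence of the second Bianchi identity. The same
cancellation of the normal derivative gives A_{⊥⊥j} = -DᵇE_{jb} + KᵃᵇC_{jab⊥} (`cottonNNT_eq`).
Substitution into -∇ᶜA_{abc} + PᵈᶜC_{dacb} yields `bach_normal_normal` and `bach_tang_normal`.

The curvature identities are derived in coordinates. With the Christoffel symbols gathered into
matrices Γₐ, curvature is a difference of derivatives plus a commutator, and its symmetries become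
identities in a noncommutative ring. -/

noncomputable section

namespace BachConstraint

/-! ### Calculus of partial derivatives within a domain -/

/-- A domain on which derivatives within it are unique and second derivatives commute. -/
structure RegularDomain {n : ℕ} (s : Set (Coord n)) : Prop where
  uniqueDiffOn : UniqueDiffOn ℝ s
  subset_closure : s ⊆ closure (interior s)

lemma RegularDomain.of_isOpen {n : ℕ} {s : Set (Coord n)} (hs : IsOpen s) : RegularDomain s :=
  ⟨hs.uniqueDiffOn, by rw [hs.interior_eq]; exact _root_.subset_closure⟩

section Calculus

variable {n : ℕ} {s : Set (Coord n)} {i j : Fin n} {f f' : Coord n → ℝ} {x : Coord n}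

lemma diffAt (hf : ContDiffOn ℝ ∞ f s) (hx : x ∈ s) : DifferentiableWithinAt ℝ f s x :=
  (hf.differentiableOn (by simp)) x hx

lemma pd_congr (h : EqOn f f' s) (hx : x ∈ s) : pd s i f x = pd s i f' x := by
  unfold pd; rw [fderivWithin_congr h (h hx)]

lemma contDiffOn_pd (hs : RegularDomain s) (hf : ContDiffOn ℝ ∞ f s) :
    ContDiffOn ℝ ∞ (pd s i f) s :=
  (hf.fderivWithin hs.uniqueDiffOn (by simp)).clm_apply contDiffOn_const

lemma pd_add (hs : RegularDomain s) (hf : ContDiffOn ℝ ∞ f s) (hf' : ContDiffOn ℝ ∞ f' s)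
    (hx : x ∈ s) : pd s i (fun y => f y + f' y) x = pd s i f x + pd s i f' x := by
  unfold pd
  rw [fderivWithin_fun_add (hs.uniqueDiffOn x hx) (diffAt hf hx) (diffAt hf' hx)]; rfl

lemma pd_sub (hs : RegularDomain s) (hf : ContDiffOn ℝ ∞ f s) (hf' : ContDiffOn ℝ ∞ f' s)
    (hx : x ∈ s) : pd s i (fun y => f y - f' y) x = pd s i f x - pd s i f' x := by
  unfold pd
  rw [fderivWithin_fun_sub (hs.uniqueDiffOn x hx) (diffAt hf hx) (diffAt hf' hx)]; rfl

lemma pd_neg (hs : RegularDomain s) (hx : x ∈ s) :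
    pd s i (fun y => - f y) x = - pd s i f x := by
  unfold pd
  rw [fderivWithin_fun_neg (hs.uniqueDiffOn x hx)]; rfl

lemma pd_mul (hs : RegularDomain s) (hf : ContDiffOn ℝ ∞ f s) (hf' : ContDiffOn ℝ ∞ f' s)
    (hx : x ∈ s) : pd s i (fun y => f y * f' y) x = pd s i f x * f' x + f x * pd s i f' x := by
  unfold pd
  rw [fderivWithin_fun_mul (hs.uniqueDiffOn x hx) (diffAt hf hx) (diffAt hf' hx)]
  simp; ring

lemma pd_const (c : ℝ) : pd s i (fun _ => c) x = 0 := by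
  simp [pd]

lemma pd_const_mul (hs : RegularDomain s) (hf : ContDiffOn ℝ ∞ f s) (hx : x ∈ s) (c : ℝ) :
    pd s i (fun y => c * f y) x = c * pd s i f x := by
  rw [pd_mul hs contDiffOn_const hf hx, pd_const]; ring

lemma pd_sum {ι : Type*} (u : Finset ι) {F : ι → Coord n → ℝ} (hs : RegularDomain s)
    (hF : ∀ k, ContDiffOn ℝ ∞ (F k) s) (hx : x ∈ s) :
    pd s i (fun y => ∑ k ∈ u, F k y) x = ∑ k ∈ u, pd s i (F k) x := by
  unfold pd
  rw [fderivWithin_fun_sum (hs.uniqueDiffOn x hx) (fun k _ => diffAt (hF k) hx)]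
  simp

/-- At a boundary point the symmetry of the second derivative is a limit of the interior case; this
is the purpose of `subset_closure`. -/
lemma pd_comm (hs : RegularDomain s) (hf : ContDiffOn ℝ ∞ f s) (hx : x ∈ s) :
    pd s i (pd s j f) x = pd s j (pd s i f) x := by
  have hd : DifferentiableWithinAt ℝ (fderivWithin ℝ f s) s x :=
    (hf.fderivWithin (m := ∞) hs.uniqueDiffOn (by simp)).differentiableOn (by simp) x hx
  have key : ∀ k l : Fin n, pd s k (pd s l f) x =
      fderivWithin ℝ (fderivWithin ℝ f s) s x (EuclideanSpace.single k 1)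
        (EuclideanSpace.single l 1) := by
    intro k l
    have : pd s l f = fun y => fderivWithin ℝ f s y (EuclideanSpace.single l 1) := rfl
    rw [this, pd, fderivWithin_clm_apply (hs.uniqueDiffOn x hx) hd
      (differentiableWithinAt_const _)]
    simp
  rw [key, key]
  refine (hf x hx).isSymmSndFDerivWithinAt ?_ hs.uniqueDiffOn (hs.subset_closure hx) hx _ _
  -- Over ℝ the symmetry needs two derivatives only.
  rw [minSmoothness_of_isRCLikeNormedField]
  exact WithTop.coe_le_coe.2 (le_top (a := (2 : ℕ∞)))

/-- The chain rule for the restriction of a function to a parametrized surface. -/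
lemma pd_comp {m : ℕ} {V : Set (Coord m)} {φ : Coord m → Coord n} {k : Fin m} {u : Coord m}
    (hV : RegularDomain V) (hf : ContDiffOn ℝ ∞ f s)
    (hφ : ContDiffOn ℝ ∞ φ V) (hm : MapsTo φ V s) (hu : u ∈ V) :
    pd V k (fun w => f (φ w)) u = ∑ a, pd V k (fun w => φ w a) u * pd s a f (φ u) := by
  have hd : DifferentiableWithinAt ℝ φ V u := hφ.differentiableOn (by simp) u hu
  have h1 : fderivWithin ℝ (fun w => f (φ w)) V u =
      (fderivWithin ℝ f s (φ u)).comp (fderivWithin ℝ φ V u) :=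
    fderivWithin_comp u (diffAt hf (hm hu)) hd hm (hV.uniqueDiffOn u hu)
  have h2 : ∀ a, pd V k (fun w => φ w a) u = fderivWithin ℝ φ V u (EuclideanSpace.single k 1) a := by
    intro a
    have := ((EuclideanSpace.proj (𝕜 := ℝ) a).hasFDerivAt.comp_hasFDerivWithinAt u
      hd.hasFDerivWithinAt).fderivWithin (hV.uniqueDiffOn u hu)
    have h3 : (fun w => φ w a) = (EuclideanSpace.proj (𝕜 := ℝ) a) ∘ φ := rfl
    rw [pd, h3, this]; rfl
  simp only [h2]
  rw [pd, h1, ContinuousLinearMap.comp_apply]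
  set X := fderivWithin ℝ φ V u (EuclideanSpace.single k 1)
  have hX : X = ∑ a, X a • EuclideanSpace.single a (1 : ℝ) := by
    ext b; simp [Pi.single_apply]
  conv_lhs => rw [hX]
  simp [pd]

lemma contDiffOn_coord {m : ℕ} {V : Set (Coord m)} {φ : Coord m → Coord n}
    (hφ : ContDiffOn ℝ ∞ φ V) (a : Fin n) : ContDiffOn ℝ ∞ (fun w => φ w a) V :=
  (EuclideanSpace.proj (𝕜 := ℝ) a).contDiff.comp_contDiffOn hφ

lemma contDiffOn_det {m : ℕ} {A : Coord n → Matrix (Fin m) (Fin m) ℝ}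
    (hA : ∀ a b, ContDiffOn ℝ ∞ (fun y => A y a b) s) :
    ContDiffOn ℝ ∞ (fun y => (A y).det) s := by
  simp only [Matrix.det_apply]
  refine ContDiffOn.sum fun σ _ => ContDiffOn.const_smul _ (contDiffOn_prod fun k _ => hA _ _)

/-- Cramer's rule: the entries of the adjugate are determinants of matrices with one row replaced by
a constant one. -/
lemma contDiffOn_inv {m : ℕ} {A : Coord n → Matrix (Fin m) (Fin m) ℝ}
    (hA : ∀ a b, ContDiffOn ℝ ∞ (fun y => A y a b) s) (hd : ∀ y ∈ s, (A y).det ≠ 0)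
    (a b : Fin m) : ContDiffOn ℝ ∞ (fun y => (A y)⁻¹ a b) s := by
  simp only [Matrix.inv_def, Ring.inverse_eq_inv', Matrix.smul_apply, smul_eq_mul,
    Matrix.adjugate_apply]
  refine ((contDiffOn_det hA).inv hd).mul (contDiffOn_det fun c d => ?_)
  simp only [Matrix.updateRow_apply]
  split_ifs
  · exact contDiffOn_const
  · exact hA _ _

end Calculus

/-! ### The Levi-Civita connection in matrix form -/

/-- A smooth field of nondegenerate symmetric matrices on `s`. -/
structure IsMetricOn {n : ℕ} (s : Set (Coord n)) (g : Coord n → Matrix (Fin n) (Fin n) ℝ) :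
    Prop where
  smooth : ∀ a b, ContDiffOn ℝ ∞ (fun y => g y a b) s
  symm : ∀ y ∈ s, (g y).IsSymm
  det_ne_zero : ∀ y ∈ s, (g y).det ≠ 0

/-! ### Entrywise differentiation of matrix-valued functions. -/

section Matrices

variable {n : ℕ} {s : Set (Coord n)} {x : Coord n} {m : Type*}

/-- The entrywise partial derivative of a matrix-valued function. -/
def mpd (s : Set (Coord n)) (i : Fin n) (A : Coord n → Matrix m m ℝ) (x : Coord n) :
    Matrix m m ℝ :=
  Matrix.of fun a b => pd s i (fun y => A y a b) x

/-- A matrix-valued function with smooth entries. -/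
def SmoothMat (s : Set (Coord n)) (A : Coord n → Matrix m m ℝ) : Prop :=
  ∀ a b, ContDiffOn ℝ ∞ (fun y => A y a b) s

lemma SmoothMat.add {A B : Coord n → Matrix m m ℝ} (hA : SmoothMat s A) (hB : SmoothMat s B) :
    SmoothMat s (fun y => A y + B y) := fun a b => (hA a b).add (hB a b)

lemma SmoothMat.sub {A B : Coord n → Matrix m m ℝ} (hA : SmoothMat s A) (hB : SmoothMat s B) :
    SmoothMat s (fun y => A y - B y) := fun a b => (hA a b).sub (hB a b)

lemma SmoothMat.mul [Fintype m] {A B : Coord n → Matrix m m ℝ} (hA : SmoothMat s A) (hB : SmoothMat s B) :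
    SmoothMat s (fun y => A y * B y) := fun a b => by
  simp only [Matrix.mul_apply]
  exact ContDiffOn.sum fun c _ => (hA a c).mul (hB c b)

lemma SmoothMat.mpd {A : Coord n → Matrix m m ℝ} (hs : RegularDomain s) (hA : SmoothMat s A)
    (i : Fin n) : SmoothMat s (mpd s i A) := fun a b => contDiffOn_pd hs (hA a b)

lemma mpd_congr {A B : Coord n → Matrix m m ℝ} {i : Fin n} (h : EqOn A B s) (hx : x ∈ s) :
    mpd s i A x = mpd s i B x := by
  ext a b
  exact pd_congr (fun y hy => congrFun (congrFun (h hy) a) b) hx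

lemma mpd_add {A B : Coord n → Matrix m m ℝ} {i : Fin n} (hs : RegularDomain s)
    (hA : SmoothMat s A) (hB : SmoothMat s B) (hx : x ∈ s) :
    mpd s i (fun y => A y + B y) x = mpd s i A x + mpd s i B x := by
  ext a b
  exact pd_add hs (hA a b) (hB a b) hx

lemma mpd_sub {A B : Coord n → Matrix m m ℝ} {i : Fin n} (hs : RegularDomain s)
    (hA : SmoothMat s A) (hB : SmoothMat s B) (hx : x ∈ s) :
    mpd s i (fun y => A y - B y) x = mpd s i A x - mpd s i B x := by
  ext a b
  exact pd_sub hs (hA a b) (hB a b) hx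

lemma mpd_mul [Fintype m] {A B : Coord n → Matrix m m ℝ} {i : Fin n} (hs : RegularDomain s)
    (hA : SmoothMat s A) (hB : SmoothMat s B) (hx : x ∈ s) :
    mpd s i (fun y => A y * B y) x = mpd s i A x * B x + A x * mpd s i B x := by
  ext a b
  simp only [mpd, Matrix.mul_apply, Matrix.of_apply, Matrix.add_apply]
  rw [pd_sum _ hs (fun c => (hA a c).mul (hB c b)) hx, ← Finset.sum_add_distrib]
  exact Finset.sum_congr rfl fun c _ => pd_mul hs (hA a c) (hB c b) hx

lemma mpd_comm {A : Coord n → Matrix m m ℝ} {i j : Fin n} (hs : RegularDomain s)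
    (hA : SmoothMat s A) (hx : x ∈ s) :
    mpd s i (mpd s j A) x = mpd s j (mpd s i A) x := by
  ext a b
  exact pd_comm hs (hA a b) hx

end Matrices

/-! ### Metric compatibility and torsion-freeness of the connection. -/

section Connection

variable {n : ℕ} {s : Set (Coord n)} {g : Coord n → Matrix (Fin n) (Fin n) ℝ} {x : Coord n}

/-- The connection matrices `(Γₐ)_{ce} = Γᵉₐ꜀`. -/
def conn (s : Set (Coord n)) (g : Coord n → Matrix (Fin n) (Fin n) ℝ) (a : Fin n) (x : Coord n) :
    Matrix (Fin n) (Fin n) ℝ :=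
  Matrix.of fun c e => christoffel s g x e a c

lemma IsMetricOn.apply_comm (hg : IsMetricOn s g) (hx : x ∈ s) (a b : Fin n) :
    g x a b = g x b a := (hg.symm x hx).apply b a

lemma IsMetricOn.isUnit_det (hg : IsMetricOn s g) (hx : x ∈ s) : IsUnit (g x).det :=
  (hg.det_ne_zero x hx).isUnit

lemma IsMetricOn.inv_apply_comm (hg : IsMetricOn s g) (hx : x ∈ s) (a b : Fin n) :
    (g x)⁻¹ a b = (g x)⁻¹ b a := by
  have h : ((g x)⁻¹).transpose = (g x)⁻¹ := by rw [Matrix.transpose_nonsing_inv, hg.symm x hx]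
  exact congrFun (congrFun h b) a

lemma IsMetricOn.pd_comm_apply (hg : IsMetricOn s g) (hx : x ∈ s) (k a b : Fin n) :
    pd s k (fun y => g y a b) x = pd s k (fun y => g y b a) x :=
  pd_congr (fun _ hy => hg.apply_comm hy a b) hx

lemma christoffel_comm (hg : IsMetricOn s g) (hx : x ∈ s) (k i j : Fin n) :
    christoffel s g x k i j = christoffel s g x k j i := by
  unfold christoffel
  congr 1
  refine Finset.sum_congr rfl fun l _ => ?_
  rw [hg.pd_comm_apply hx l i j]; ring

lemma contDiffOn_christoffel (hs : RegularDomain s) (hg : IsMetricOn s g) (k i j : Fin n) :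
    ContDiffOn ℝ ∞ (fun y => christoffel s g y k i j) s := by
  unfold christoffel
  refine contDiffOn_const.mul (ContDiffOn.sum fun l _ => ?_)
  exact (contDiffOn_inv hg.smooth hg.det_ne_zero k l).mul
    (((contDiffOn_pd hs (hg.smooth _ _)).add (contDiffOn_pd hs (hg.smooth _ _))).sub
      (contDiffOn_pd hs (hg.smooth _ _)))

lemma smoothMat_conn (hs : RegularDomain s) (hg : IsMetricOn s g) (a : Fin n) :
    SmoothMat s (conn s g a) := fun c e => contDiffOn_christoffel hs hg e a c

/-- The Christoffel symbols of the first kind. -/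
lemma sum_metric_christoffel (hg : IsMetricOn s g) (hx : x ∈ s) (b i j : Fin n) :
    ∑ k, g x b k * christoffel s g x k i j = (1 / 2) *
      (pd s i (fun y => g y b j) x + pd s j (fun y => g y b i) x - pd s b (fun y => g y i j) x) := by
  have h1 := Matrix.mul_nonsing_inv (g x) (hg.isUnit_det hx)
  unfold christoffel
  simp only [Finset.mul_sum]
  rw [Finset.sum_comm]
  have h2 : ∀ l, ∑ k, g x b k * (g x)⁻¹ k l = if b = l then 1 else 0 := fun l => by
    rw [← Matrix.mul_apply, h1, Matrix.one_apply]
  have h3 : ∀ l (q : ℝ), ∑ k, g x b k * (1 / 2 * ((g x)⁻¹ k l * q)) =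
      (1 / 2) * ((if b = l then 1 else 0) * q) := fun l q => by
    rw [← h2, Finset.sum_mul, Finset.mul_sum]
    exact Finset.sum_congr rfl fun k _ => by ring
  simp only [h3]
  simp

/-- Metric compatibility in matrix form. In the sum of two Christoffel symbols of the first kind the
derivatives in the directions a and b cancel, and two halves of the derivative in the direction k
remain. -/
lemma mpd_metric (hg : IsMetricOn s g) (hx : x ∈ s) (k : Fin n) :
    mpd s k g x = conn s g k x * g x + g x * (conn s g k x).transpose := by
  ext a b
  have h1 := sum_metric_christoffel hg hx b k a
  have h2 := sum_metric_christoffel hg hx a k b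
  simp only [mpd, conn, Matrix.add_apply, Matrix.mul_apply, Matrix.of_apply,
    Matrix.transpose_apply]
  have h3 : ∀ l, christoffel s g x l k a * g x l b = g x b l * christoffel s g x l k a :=
    fun l => by rw [hg.apply_comm hx l b, mul_comm]
  simp only [h3]
  rw [h1, h2, hg.pd_comm_apply hx k b a, hg.pd_comm_apply hx a b k, hg.pd_comm_apply hx b a k]
  ring

lemma pd_metric (hg : IsMetricOn s g) (hx : x ∈ s) (k a b : Fin n) :
    pd s k (fun y => g y a b) x = ∑ l, christoffel s g x l k a * g x l b
      + ∑ l, christoffel s g x l k b * g x a l := by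
  have h := congrFun (congrFun (mpd_metric hg hx k) a) b
  simp only [mpd, conn, Matrix.add_apply, Matrix.mul_apply, Matrix.of_apply,
    Matrix.transpose_apply] at h
  rw [h]
  congr 1
  exact Finset.sum_congr rfl fun l _ => mul_comm _ _

lemma cov2_metric (hg : IsMetricOn s g) (hx : x ∈ s) (k a b : Fin n) :
    cov2 s g (fun y a b => g y a b) x k a b = 0 := by
  rw [cov2, pd_metric hg hx]; ring

/-- Obtained by differentiating g g⁻¹ = 1 and multiplying by g⁻¹ on the left. -/
lemma mpd_metric_inv (hs : RegularDomain s) (hg : IsMetricOn s g) (hx : x ∈ s) (k : Fin n) :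
    mpd s k (fun y => (g y)⁻¹) x
      = -((g x)⁻¹ * conn s g k x + (conn s g k x).transpose * (g x)⁻¹) := by
  have hinv : SmoothMat s (fun y => (g y)⁻¹) := contDiffOn_inv hg.smooth hg.det_ne_zero
  have h1 : mpd s k (fun y => g y * (g y)⁻¹) x = 0 := by
    rw [mpd_congr (B := fun _ => 1) (fun y hy => Matrix.mul_nonsing_inv _ (hg.isUnit_det hy)) hx]
    ext a b
    exact pd_const _
  rw [mpd_mul hs hg.smooth hinv hx, mpd_metric hg hx] at h1
  have h2 := Matrix.nonsing_inv_mul (g x) (hg.isUnit_det hx)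
  have h3 := Matrix.mul_nonsing_inv (g x) (hg.isUnit_det hx)
  have h4 := congrArg (fun A => (g x)⁻¹ * A) h1
  simp only [Matrix.mul_add, Matrix.add_mul, Matrix.mul_zero, Matrix.mul_assoc, h3,
    Matrix.mul_one] at h4
  simp only [← Matrix.mul_assoc, h2, Matrix.one_mul] at h4
  rw [← sub_eq_zero, ← h4]
  abel

/-! ### Traces -/

lemma tr_add (G : Matrix (Fin n) (Fin n) ℝ) (t r : Fin n → Fin n → ℝ) :
    tr G (fun a b => t a b + r a b) = tr G t + tr G r := by
  simp [tr, mul_add, Finset.sum_add_distrib]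

lemma tr_sub (G : Matrix (Fin n) (Fin n) ℝ) (t r : Fin n → Fin n → ℝ) :
    tr G (fun a b => t a b - r a b) = tr G t - tr G r := by
  simp [tr, mul_sub, Finset.sum_sub_distrib]

lemma tr_neg (G : Matrix (Fin n) (Fin n) ℝ) (t : Fin n → Fin n → ℝ) :
    tr G (fun a b => - t a b) = - tr G t := by
  simp [tr, Finset.sum_neg_distrib]

lemma tr_const_mul (G : Matrix (Fin n) (Fin n) ℝ) (c : ℝ) (t : Fin n → Fin n → ℝ) :
    tr G (fun a b => c * t a b) = c * tr G t := by
  simp only [tr, Finset.mul_sum]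
  exact Finset.sum_congr rfl fun a _ => Finset.sum_congr rfl fun b _ => by ring

lemma tr_sum {ι : Type*} (u : Finset ι) (G : Matrix (Fin n) (Fin n) ℝ)
    (t : ι → Fin n → Fin n → ℝ) :
    tr G (fun a b => ∑ k ∈ u, t k a b) = ∑ k ∈ u, tr G (t k) := by
  simp only [tr, Finset.mul_sum]
  symm
  rw [Finset.sum_comm]
  refine Finset.sum_congr rfl fun a _ => ?_
  rw [Finset.sum_comm]

lemma tr_swap (hg : IsMetricOn s g) (hx : x ∈ s) (t : Fin n → Fin n → ℝ) :
    tr (g x) (fun a b => t b a) = tr (g x) t := by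
  rw [tr, Finset.sum_comm]
  exact Finset.sum_congr rfl fun a _ => Finset.sum_congr rfl fun b _ => by
    rw [hg.inv_apply_comm hx]

/-- Gives access to the cyclicity of the matrix trace, used in `pd_tr`. -/
lemma tr_eq_trace (hg : IsMetricOn s g) (hx : x ∈ s) (t : Fin n → Fin n → ℝ) :
    tr (g x) t = ((g x)⁻¹ * Matrix.of t).trace := by
  simp only [tr, Matrix.trace, Matrix.diag, Matrix.mul_apply, Matrix.of_apply]
  rw [Finset.sum_comm]
  exact Finset.sum_congr rfl fun a _ => Finset.sum_congr rfl fun b _ => by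
    rw [hg.inv_apply_comm hx]

lemma tr_metric_mul (hg : IsMetricOn s g) (hx : x ∈ s) (t : Fin n → ℝ) (c : Fin n) :
    tr (g x) (fun k a => g x c a * t k) = t c := by
  have h1 := Matrix.nonsing_inv_mul (g x) (hg.isUnit_det hx)
  have h2 : ∀ k, ∑ a, (g x)⁻¹ k a * (g x c a * t k) = if k = c then t k else 0 := fun k => by
    have h3 := congrFun (congrFun h1 k) c
    rw [Matrix.mul_apply, Matrix.one_apply] at h3
    have h4 : ∑ a, (g x)⁻¹ k a * (g x c a * t k) = (∑ a, (g x)⁻¹ k a * g x a c) * t k := by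
      rw [Finset.sum_mul]
      exact Finset.sum_congr rfl fun a _ => by rw [hg.apply_comm hx c a]; ring
    rw [h4, h3]
    split_ifs <;> simp
  rw [tr, Finset.sum_congr rfl fun k _ => h2 k]
  simp

lemma contDiffOn_tr (hg : IsMetricOn s g) {T : Coord n → Fin n → Fin n → ℝ}
    (hT : ∀ a b, ContDiffOn ℝ ∞ (fun y => T y a b) s) :
    ContDiffOn ℝ ∞ (fun y => tr (g y) (T y)) s :=
  ContDiffOn.sum fun a _ => ContDiffOn.sum fun b _ =>
    (contDiffOn_inv hg.smooth hg.det_ne_zero a b).mul (hT a b)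

/-- The metric trace commutes with covariant differentiation. -/
lemma pd_tr (hs : RegularDomain s) (hg : IsMetricOn s g) {T : Coord n → Fin n → Fin n → ℝ}
    (hT : ∀ a b, ContDiffOn ℝ ∞ (fun y => T y a b) s) (hx : x ∈ s) (k : Fin n) :
    pd s k (fun y => tr (g y) (T y)) x = tr (g x) (cov2 s g T x k) := by
  have hinv : SmoothMat s (fun y => (g y)⁻¹) := contDiffOn_inv hg.smooth hg.det_ne_zero
  have hTm : SmoothMat s (fun y => Matrix.of (T y)) := hT
  have h1 : pd s k (fun y => tr (g y) (T y)) x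
      = (mpd s k (fun y => (g y)⁻¹ * Matrix.of (T y)) x).trace := by
    rw [pd_congr (f' := fun y => ∑ a, ((g y)⁻¹ * Matrix.of (T y)) a a)
      (fun y hy => tr_eq_trace hg hy _) hx, pd_sum _ hs (fun a => (hinv.mul hTm) a a) hx]
    rfl
  have h2 : Matrix.of (cov2 s g T x k) = mpd s k (fun y => Matrix.of (T y)) x
      - conn s g k x * Matrix.of (T x) - Matrix.of (T x) * (conn s g k x).transpose := by
    ext a b
    simp only [cov2, mpd, conn, Matrix.sub_apply, Matrix.mul_apply, Matrix.of_apply,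
      Matrix.transpose_apply]
    congr 1
    exact Finset.sum_congr rfl fun l _ => mul_comm _ _
  rw [h1, mpd_mul hs hinv hTm hx, mpd_metric_inv hs hg hx, tr_eq_trace hg hx, h2]
  simp only [Matrix.mul_sub, Matrix.add_mul, Matrix.neg_mul, Matrix.trace_add, Matrix.trace_sub,
    Matrix.trace_neg]
  -- By cyclicity the Γᵀ term from the derivative of g⁻¹ matches the one in the covariant derivative
  -- of T; the Γ terms agree already.
  rw [← Matrix.mul_assoc, ← Matrix.mul_assoc,
    Matrix.trace_mul_comm ((g x)⁻¹ * Matrix.of (T x)) (conn s g k x).transpose,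
    ← Matrix.mul_assoc]
  ring

lemma contDiffOn_cov2 (hs : RegularDomain s) (hg : IsMetricOn s g)
    {t : Coord n → Fin n → Fin n → ℝ} (ht : ∀ a b, ContDiffOn ℝ ∞ (fun y => t y a b) s)
    (k a b : Fin n) : ContDiffOn ℝ ∞ (fun y => cov2 s g t y k a b) s :=
  ((contDiffOn_pd hs (ht a b)).sub
    (ContDiffOn.sum fun l _ => (contDiffOn_christoffel hs hg l k a).mul (ht l b))).sub
    (ContDiffOn.sum fun l _ => (contDiffOn_christoffel hs hg l k b).mul (ht a l))

/-! ### Covariant derivatives of tensors of rank four -/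

/-- The covariant derivative `∇ₖ tₐᵦ꜀ᵈ`. -/
def cov4 (s : Set (Coord n)) (g : Coord n → Matrix (Fin n) (Fin n) ℝ)
    (t : Coord n → Fin n → Fin n → Fin n → Fin n → ℝ) (x : Coord n) (k a b c d : Fin n) : ℝ :=
  pd s k (fun y => t y a b c d) x - ∑ l, christoffel s g x l k a * t x l b c d
    - ∑ l, christoffel s g x l k b * t x a l c d - ∑ l, christoffel s g x l k c * t x a b l d
    - ∑ l, christoffel s g x l k d * t x a b c l

variable {t r : Coord n → Fin n → Fin n → Fin n → Fin n → ℝ}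

/-- A rank-four tensor field with smooth components. -/
def Smooth4 (s : Set (Coord n)) (t : Coord n → Fin n → Fin n → Fin n → Fin n → ℝ) : Prop :=
  ∀ a b c d, ContDiffOn ℝ ∞ (fun y => t y a b c d) s

lemma cov4_congr (h : EqOn t r s) (hx : x ∈ s) : cov4 s g t x = cov4 s g r x := by
  funext k a b c d
  simp only [cov4, h hx]
  rw [pd_congr (f' := fun y => r y a b c d) (fun y hy => by rw [h hy]) hx]

lemma cov4_add (hs : RegularDomain s) (ht : Smooth4 s t) (hr : Smooth4 s r) (hx : x ∈ s)
    (k a b c d : Fin n) :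
    cov4 s g (fun y a b c d => t y a b c d + r y a b c d) x k a b c d
      = cov4 s g t x k a b c d + cov4 s g r x k a b c d := by
  simp only [cov4, mul_add, Finset.sum_add_distrib, pd_add hs (ht a b c d) (hr a b c d) hx]
  ring

lemma cov4_neg (hs : RegularDomain s) (hx : x ∈ s) (k a b c d : Fin n) :
    cov4 s g (fun y a b c d => - t y a b c d) x k a b c d = - cov4 s g t x k a b c d := by
  simp only [cov4, mul_neg, Finset.sum_neg_distrib, pd_neg hs hx]
  ring

lemma cov4_sub (hs : RegularDomain s) (ht : Smooth4 s t) (hr : Smooth4 s r) (hx : x ∈ s)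
    (k a b c d : Fin n) :
    cov4 s g (fun y a b c d => t y a b c d - r y a b c d) x k a b c d
      = cov4 s g t x k a b c d - cov4 s g r x k a b c d := by
  simp only [cov4, mul_sub, Finset.sum_sub_distrib, pd_sub hs (ht a b c d) (hr a b c d) hx]
  ring

lemma cov4_swap12 (k a b c d : Fin n) :
    cov4 s g (fun y a b c d => t y b a c d) x k a b c d = cov4 s g t x k b a c d := by
  simp only [cov4]; ring

lemma cov4_swap34 (k a b c d : Fin n) :
    cov4 s g (fun y a b c d => t y a b d c) x k a b c d = cov4 s g t x k a b d c := by
  simp only [cov4]; ring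

lemma cov4_pair (k a b c d : Fin n) :
    cov4 s g (fun y a b c d => t y c d a b) x k a b c d = cov4 s g t x k c d a b := by
  simp only [cov4]; ring

/-- The Leibniz rule for the product of the metric and a tensor. -/
lemma cov4_metric_mul (hs : RegularDomain s) (hg : IsMetricOn s g)
    {p : Coord n → Fin n → Fin n → ℝ} (hp : ∀ a b, ContDiffOn ℝ ∞ (fun y => p y a b) s)
    (hx : x ∈ s) (k a b c d : Fin n) :
    cov4 s g (fun y a b c d => g y c a * p y b d) x k a b c d
      = g x c a * cov2 s g p x k b d := by
  -- The connection terms on the two indices of g cancel the derivative of g; those on b and d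
  -- complete the derivative of p.
  simp only [cov4, cov2, pd_mul hs (hg.smooth c a) (hp b d) hx, pd_metric hg hx, add_mul, mul_sub,
    Finset.sum_mul, Finset.mul_sum]
  simp only [mul_comm, mul_left_comm]
  ring

/-- The trace over the first and third index commutes with covariant differentiation. -/
lemma cov2_tr (hs : RegularDomain s) (hg : IsMetricOn s g) (ht : Smooth4 s t) (hx : x ∈ s)
    (k b d : Fin n) :
    cov2 s g (fun y b d => tr (g y) fun a c => t y a b c d) x k b d
      = tr (g x) fun a c => cov4 s g t x k a b c d := by
  have h : (fun a c => cov4 s g t x k a b c d) = fun a c =>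
      cov2 s g (fun y a c => t y a b c d) x k a c
        - ∑ l, christoffel s g x l k b * t x a l c d
        - ∑ l, christoffel s g x l k d * t x a b c l := by
    funext a c
    simp only [cov4, cov2]; ring
  rw [h, tr_sub, tr_sub, tr_sum, tr_sum, cov2, pd_tr hs hg (fun a c => ht a b c d) hx]
  simp only [tr_const_mul]

end Connection

/-! ### Curvature identities -/

section Curvature

variable {s : Set (Coord 4)} {g : Coord 4 → Matrix (Fin 4) (Fin 4) ℝ} {x : Coord 4}

/-- The curvature matrices `(Rₐᵦ)_{ce} = Rₐᵦ꜀ᵉ`. -/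
def curv (s : Set (Coord 4)) (g : Coord 4 → Matrix (Fin 4) (Fin 4) ℝ) (a b : Fin 4)
    (x : Coord 4) : Matrix (Fin 4) (Fin 4) ℝ :=
  mpd s b (conn s g a) x - mpd s a (conn s g b) x
    + (conn s g a x * conn s g b x - conn s g b x * conn s g a x)

/-- The last index is lowered by right multiplication with g, so statements about Riemann become
statements about the matrices `curv`. -/
lemma riemann_eq_curv (a b c d : Fin 4) :
    riemann s g x a b c d = (curv s g a b x * g x) c d := by
  simp only [riemann, curv, Matrix.mul_apply, mpd, conn, Matrix.add_apply, Matrix.sub_apply,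
    Matrix.of_apply, ← Finset.sum_sub_distrib]
  exact Finset.sum_congr rfl fun e _ => mul_comm _ _

lemma smoothMat_curv (hs : RegularDomain s) (hg : IsMetricOn s g) (a b : Fin 4) :
    SmoothMat s (curv s g a b) :=
  have hc := smoothMat_conn hs hg
  (((hc a).mpd hs b).sub ((hc b).mpd hs a)).add (((hc a).mul (hc b)).sub ((hc b).mul (hc a)))

lemma curv_swap (a b : Fin 4) : curv s g b a x = - curv s g a b x := by
  simp only [curv]; abel

lemma smooth4_riemann (hs : RegularDomain s) (hg : IsMetricOn s g) : Smooth4 s (riemann s g) :=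
  fun a b c d => by
    simp only [riemann_eq_curv]
    exact ((smoothMat_curv hs hg a b).mul hg.smooth) c d

/-! ### Algebraic and differential symmetries of the Riemann tensor. -/

lemma riemann_swap12 (a b c d : Fin 4) : riemann s g x b a c d = - riemann s g x a b c d := by
  rw [riemann_eq_curv, riemann_eq_curv, curv_swap, Matrix.neg_mul, Matrix.neg_apply]

lemma mpd_transpose {i : Fin 4} (A : Coord 4 → Matrix (Fin 4) (Fin 4) ℝ) :
    mpd s i (fun y => (A y).transpose) x = (mpd s i A x).transpose := rfl

/-- The second derivatives of the metric commute. Expanding both orders through ∂g = Γg + gΓᵀ, the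
difference is F g + (F g)ᵀ with F the curvature matrix, so F g is antisymmetric. -/
lemma riemann_swap34 (hs : RegularDomain s) (hg : IsMetricOn s g) (hx : x ∈ s)
    (a b c d : Fin 4) : riemann s g x a b d c = - riemann s g x a b c d := by
  have hc := smoothMat_conn hs hg
  have hct : ∀ a, SmoothMat s (fun y => (conn s g a y).transpose) := fun a c d => hc a d c
  have hgs : SmoothMat s g := hg.smooth
  have h1 : ∀ a b, mpd s b (mpd s a g) x =
      mpd s b (conn s g a) x * g x
        + conn s g a x * (conn s g b x * g x + g x * (conn s g b x).transpose)
        + ((conn s g b x * g x + g x * (conn s g b x).transpose) * (conn s g a x).transpose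
          + g x * (mpd s b (conn s g a) x).transpose) := fun a b => by
    rw [mpd_congr (fun y hy => mpd_metric hg hy a) hx,
      mpd_add hs ((hc a).mul hgs) (hgs.mul (hct a)) hx, mpd_mul hs (hc a) hgs hx,
      mpd_mul hs hgs (hct a) hx, mpd_metric hg hx b, mpd_transpose]
  have h2 : curv s g a b x * g x + (curv s g a b x * g x).transpose = 0 := by
    have h3 := mpd_comm (i := b) (j := a) hs hgs hx
    rw [h1, h1, ← sub_eq_zero] at h3
    rw [← h3]
    simp only [curv, Matrix.transpose_mul, Matrix.transpose_add, Matrix.transpose_sub,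
      (hg.symm x hx).eq]
    noncomm_ring
  have h4 := congrFun (congrFun h2 d) c
  rw [Matrix.add_apply, Matrix.transpose_apply, ← riemann_eq_curv, ← riemann_eq_curv,
    Matrix.zero_apply] at h4
  linarith

/-- Torsion-freeness: with Γ symmetric in its lower indices, the derivative terms and the quadratic
terms of the cyclic sum cancel in pairs. -/
lemma riemann_cyclic (hg : IsMetricOn s g) (hx : x ∈ s) (a b c d : Fin 4) :
    riemann s g x a b c d + riemann s g x b c a d + riemann s g x c a b d = 0 := by
  have h1 : ∀ k i j l, pd s l (fun y => christoffel s g y k i j) x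
      = pd s l (fun y => christoffel s g y k j i) x := fun k i j l =>
    pd_congr (fun y hy => christoffel_comm hg hy k i j) hx
  simp only [riemann, ← Finset.sum_add_distrib, ← mul_add]
  refine Finset.sum_eq_zero fun e _ => mul_eq_zero_of_right _ ?_
  rw [h1 e c a b, h1 e c b a, h1 e b a c]
  simp only [Finset.sum_sub_distrib]
  simp only [christoffel_comm hg hx _ c a, christoffel_comm hg hx _ c b,
    christoffel_comm hg hx _ b a]
  ring

/-- The classical octahedron argument: four cyclic identities are combined by means of the two
antisymmetries. -/
lemma riemann_pair (hs : RegularDomain s) (hg : IsMetricOn s g) (hx : x ∈ s) (a b c d : Fin 4) :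
    riemann s g x c d a b = riemann s g x a b c d := by
  have s12 := fun a b c d => riemann_swap12 (s := s) (g := g) (x := x) a b c d
  have s34 := fun a b c d => riemann_swap34 hs hg hx a b c d
  have cy := fun a b c d => riemann_cyclic hg hx a b c d
  linarith [cy a b c d, cy b c d a, cy c d a b, cy d a b c, s12 a b c d, s34 a b c d,
    s12 b c a d, s34 b c a d, s12 c a b d, s34 c a b d, s12 c d a b, s34 c d a b,
    s12 d b c a, s34 d b c a, s12 b d c a, s12 b c d a, s34 b d c a, s34 b c d a, s12 c d b a,
    s12 d a c b, s34 d a c b, s12 a c d b, s34 a c d b, s34 c d b a,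
    s12 a b d c, s34 a b d c, s12 b d a c, s34 b d a c, s12 d a b c, s34 d a b c]

/-- The covariant derivative of the curvature, in matrix form. -/
lemma cov4_riemann (hs : RegularDomain s) (hg : IsMetricOn s g) (hx : x ∈ s) (e a b c d : Fin 4) :
    cov4 s g (riemann s g) x e a b c d =
      ((mpd s e (curv s g a b) x - ∑ l, christoffel s g x l e a • curv s g l b x
        - ∑ l, christoffel s g x l e b • curv s g a l x
        - conn s g e x * curv s g a b x + curv s g a b x * conn s g e x) * g x) c d := by
  have hF := smoothMat_curv hs hg a b
  -- The derivative of the lowering metric absorbs the connection term on d, which leaves a common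
  -- right factor g.
  have h1 : pd s e (fun y => riemann s g y a b c d) x
      = ((mpd s e (curv s g a b) x * g x
        + curv s g a b x * (conn s g e x * g x + g x * (conn s g e x).transpose)) c d) := by
    rw [← mpd_metric hg hx, ← mpd_mul hs hF hg.smooth hx]
    exact pd_congr (fun y _ => riemann_eq_curv a b c d) hx
  rw [cov4, h1]
  have h2 : ∑ l, christoffel s g x l e c * riemann s g x a b l d
      = (conn s g e x * (curv s g a b x * g x)) c d := by
    rw [Matrix.mul_apply]
    exact Finset.sum_congr rfl fun l _ => by rw [riemann_eq_curv]; rfl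
  have h3 : ∑ l, christoffel s g x l e d * riemann s g x a b c l
      = ((curv s g a b x * g x) * (conn s g e x).transpose) c d := by
    rw [Matrix.mul_apply]
    exact Finset.sum_congr rfl fun l _ => by rw [riemann_eq_curv, mul_comm]; rfl
  have h4 : ∑ l, christoffel s g x l e a * riemann s g x l b c d
      = ((∑ l, christoffel s g x l e a • curv s g l b x) * g x) c d := by
    rw [Finset.sum_mul, Matrix.sum_apply]
    exact Finset.sum_congr rfl fun l _ => by
      rw [riemann_eq_curv, Matrix.smul_mul, Matrix.smul_apply, smul_eq_mul]
  have h5 : ∑ l, christoffel s g x l e b * riemann s g x a l c d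
      = ((∑ l, christoffel s g x l e b • curv s g a l x) * g x) c d := by
    rw [Finset.sum_mul, Matrix.sum_apply]
    exact Finset.sum_congr rfl fun l _ => by
      rw [riemann_eq_curv, Matrix.smul_mul, Matrix.smul_apply, smul_eq_mul]
  rw [h2, h3, h4, h5]
  simp only [← Matrix.sub_apply]
  refine congrFun (congrFun (?_ : (_ : Matrix (Fin 4) (Fin 4) ℝ) = _) c) d
  simp only [Matrix.sub_mul, Matrix.add_mul, Matrix.mul_add, Matrix.mul_assoc]
  abel

/-- The second Bianchi identity. -/
lemma bianchi (hs : RegularDomain s) (hg : IsMetricOn s g) (hx : x ∈ s) (e a b c d : Fin 4) :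
    cov4 s g (riemann s g) x e a b c d + cov4 s g (riemann s g) x a b e c d
      + cov4 s g (riemann s g) x b e a c d = 0 := by
  have hc := smoothMat_conn hs hg
  have h1 : ∀ e a b, mpd s e (curv s g a b) x =
      mpd s e (mpd s b (conn s g a)) x - mpd s e (mpd s a (conn s g b)) x
        + ((mpd s e (conn s g a) x * conn s g b x + conn s g a x * mpd s e (conn s g b) x)
          - (mpd s e (conn s g b) x * conn s g a x + conn s g b x * mpd s e (conn s g a) x)) :=
    fun e a b => by
      have := mpd_add (i := e) hs (((hc a).mpd hs b).sub ((hc b).mpd hs a))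
        (((hc a).mul (hc b)).sub ((hc b).mul (hc a))) hx
      rw [mpd_sub hs ((hc a).mpd hs b) ((hc b).mpd hs a) hx,
        mpd_sub hs ((hc a).mul (hc b)) ((hc b).mul (hc a)) hx, mpd_mul hs (hc a) (hc b) hx,
        mpd_mul hs (hc b) (hc a) hx] at this
      exact this
  -- The connection terms on the antisymmetric pair cancel between neighbours in the cyclic sum,
  -- since Γ is symmetric.
  have h2 : ∀ e a b, ∑ l, christoffel s g x l e a • curv s g b l x
      = - ∑ l, christoffel s g x l a e • curv s g l b x := fun e a b => by
    rw [← Finset.sum_neg_distrib]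
    exact Finset.sum_congr rfl fun l _ => by
      rw [curv_swap l b, smul_neg, christoffel_comm hg hx]
  rw [cov4_riemann hs hg hx, cov4_riemann hs hg hx, cov4_riemann hs hg hx, ← Matrix.add_apply,
    ← Matrix.add_apply, ← Matrix.add_mul, ← Matrix.add_mul]
  -- What is left is the commuting of second derivatives together with the Jacobi identity for the
  -- matrices Γ.
  suffices h : ∀ A : Matrix (Fin 4) (Fin 4) ℝ, A = 0 → (A * g x) c d = 0 from h _ (by
    rw [h1 e a b, h1 a b e, h1 b e a, mpd_comm hs (hc a) hx (i := e) (j := b),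
      mpd_comm hs (hc b) hx (i := e) (j := a), mpd_comm hs (hc e) hx (i := a) (j := b),
      h2 e b a, h2 a e b, h2 b a e]
    simp only [curv]
    noncomm_ring)
  rintro A rfl
  simp

/-! ### The contracted Bianchi identities -/

lemma contDiffOn_ricci (hs : RegularDomain s) (hg : IsMetricOn s g) (b d : Fin 4) :
    ContDiffOn ℝ ∞ (fun y => ricci s g y b d) s :=
  contDiffOn_tr hg fun a c => smooth4_riemann hs hg a b c d

lemma contDiffOn_scalar (hs : RegularDomain s) (hg : IsMetricOn s g) :
    ContDiffOn ℝ ∞ (scalar s g) s :=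
  contDiffOn_tr hg fun a b => contDiffOn_ricci hs hg a b

lemma contDiffOn_schouten (hs : RegularDomain s) (hg : IsMetricOn s g) (a b : Fin 4) :
    ContDiffOn ℝ ∞ (fun y => schouten s g y a b) s :=
  (contDiffOn_const.mul (contDiffOn_ricci hs hg a b)).sub
    (((contDiffOn_scalar hs hg).div_const 12).mul (hg.smooth a b))

lemma ricci_comm (hs : RegularDomain s) (hg : IsMetricOn s g) (hx : x ∈ s) (b d : Fin 4) :
    ricci s g x b d = ricci s g x d b := by
  rw [ricci, ricci, ← tr_swap hg hx]
  congr 1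
  funext a c
  exact riemann_pair hs hg hx a d c b

lemma schouten_comm (hs : RegularDomain s) (hg : IsMetricOn s g) (hx : x ∈ s) (b d : Fin 4) :
    schouten s g x b d = schouten s g x d b := by
  rw [schouten, schouten, ricci_comm hs hg hx, hg.apply_comm hx]

lemma cov4_riemann_swap34 (hs : RegularDomain s) (hg : IsMetricOn s g) (hx : x ∈ s)
    (e a b c d : Fin 4) :
    cov4 s g (riemann s g) x e a b d c = - cov4 s g (riemann s g) x e a b c d := by
  rw [← cov4_swap34, ← cov4_neg hs hx]
  refine congrFun (congrFun (congrFun (congrFun (congrFun (cov4_congr (fun y hy => ?_) hx)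
    e) a) b) c) d
  funext a b c d
  exact riemann_swap34 hs hg hy a b c d

lemma cov4_riemann_pair (hs : RegularDomain s) (hg : IsMetricOn s g) (hx : x ∈ s)
    (e a b c d : Fin 4) :
    cov4 s g (riemann s g) x e c d a b = cov4 s g (riemann s g) x e a b c d := by
  rw [← cov4_pair]
  refine congrFun (congrFun (congrFun (congrFun (congrFun (cov4_congr (fun y hy => ?_) hx)
    e) a) b) c) d
  funext a b c d
  exact riemann_pair hs hg hy a b c d

lemma tr_cov4_riemann (hs : RegularDomain s) (hg : IsMetricOn s g) (hx : x ∈ s)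
    (k b d : Fin 4) :
    tr (g x) (fun a c => cov4 s g (riemann s g) x k a b c d) = cov2 s g (ricci s g) x k b d :=
  (cov2_tr hs hg (smooth4_riemann hs hg) hx k b d).symm

/-- The contracted second Bianchi identity. -/
lemma div_riemann (hs : RegularDomain s) (hg : IsMetricOn s g) (hx : x ∈ s) (b c d : Fin 4) :
    tr (g x) (fun k a => cov4 s g (riemann s g) x k a b c d)
      = cov2 s g (ricci s g) x c b d - cov2 s g (ricci s g) x d b c := by
  rw [← tr_cov4_riemann hs hg hx, ← tr_cov4_riemann hs hg hx,
    ← tr_swap hg hx (fun a k => cov4 s g (riemann s g) x c a b k d),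
    ← tr_swap hg hx (fun a k => cov4 s g (riemann s g) x d a b k c), ← tr_sub]
  congr 1
  funext k a
  -- Pair symmetry moves the divergence index into the second pair, so that the Bianchi identity
  -- acts on k, c, d.
  linarith [bianchi hs hg hx k c d a b, cov4_riemann_pair hs hg hx k a b c d,
    cov4_riemann_pair hs hg hx c a b d k, cov4_riemann_pair hs hg hx d a b k c,
    cov4_riemann_swap34 hs hg hx c a b k d]

lemma cov4_riemann_swap12 (hs : RegularDomain s) (hg : IsMetricOn s g) (hx : x ∈ s)
    (e a b c d : Fin 4) :
    cov4 s g (riemann s g) x e b a c d = - cov4 s g (riemann s g) x e a b c d := by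
  rw [← cov4_riemann_pair hs hg hx, cov4_riemann_swap34 hs hg hx, cov4_riemann_pair hs hg hx]

lemma tr_comm (G H : Matrix (Fin 4) (Fin 4) ℝ) (t : Fin 4 → Fin 4 → Fin 4 → Fin 4 → ℝ) :
    tr G (fun a b => tr H (t a b)) = tr H (fun c d => tr G fun a b => t a b c d) := by
  have h : ∀ a b, tr H (t a b) = ∑ c, ∑ d, H⁻¹ c d * t a b c d := fun a b => rfl
  simp only [h]
  rw [tr_sum]
  conv_rhs => rw [tr]
  refine Finset.sum_congr rfl fun c _ => ?_
  rw [tr_sum]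
  exact Finset.sum_congr rfl fun d _ => tr_const_mul _ _ _

/-- The twice contracted second Bianchi identity. -/
lemma div_ricci (hs : RegularDomain s) (hg : IsMetricOn s g) (hx : x ∈ s) (c : Fin 4) :
    tr (g x) (fun k a => cov2 s g (ricci s g) x k a c) = (1 / 2) * pd s c (scalar s g) x := by
  -- The double trace of ∇ₖRₐᵦ꜀ᵈ is taken in two orders. One gives the divergence of Ricci; the
  -- other, by `div_riemann`, gives the gradient of the scalar curvature minus that divergence.
  have h1 : tr (g x) (fun b d => tr (g x) fun k a => cov4 s g (riemann s g) x k a b c d)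
      = tr (g x) (fun k a => cov2 s g (ricci s g) x k a c) := by
    rw [tr_comm]
    simp only [← tr_cov4_riemann hs hg hx]
    congr 1
    funext k a
    congr 1
    funext b d
    rw [cov4_riemann_swap12 hs hg hx, cov4_riemann_swap34 hs hg hx, neg_neg]
  have h2 : pd s c (scalar s g) x = tr (g x) (cov2 s g (ricci s g) x c) :=
    pd_tr hs hg (contDiffOn_ricci hs hg) hx c
  have h3 := tr_swap hg hx (fun k a => cov2 s g (ricci s g) x k a c)
  have h4 : tr (g x) (fun b d => cov2 s g (ricci s g) x d b c)
      = tr (g x) (fun k a => cov2 s g (ricci s g) x k a c) := h3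
  simp only [div_riemann hs hg hx, tr_sub] at h1
  rw [h4, ← h2] at h1
  linarith

lemma cov2_schouten (hs : RegularDomain s) (hg : IsMetricOn s g) (hx : x ∈ s) (k a b : Fin 4) :
    cov2 s g (schouten s g) x k a b
      = (1 / 2) * cov2 s g (ricci s g) x k a b - pd s k (scalar s g) x / 12 * g x a b := by
  have hR := contDiffOn_ricci hs hg a b
  have hS : ContDiffOn ℝ ∞ (fun y => scalar s g y / 12) s := (contDiffOn_scalar hs hg).div_const 12
  have h1 : pd s k (fun y => schouten s g y a b) x
      = (1 / 2) * pd s k (fun y => ricci s g y a b) x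
        - (pd s k (scalar s g) x / 12 * g x a b
          + scalar s g x / 12 * pd s k (fun y => g y a b) x) := by
    have h2 : pd s k (fun y => scalar s g y / 12) x = pd s k (scalar s g) x / 12 := by
      simp only [div_eq_inv_mul]
      exact pd_const_mul hs (contDiffOn_scalar hs hg) hx _
    simp only [schouten]
    rw [pd_sub hs (contDiffOn_const.mul hR) (hS.mul (hg.smooth a b)) hx,
      pd_const_mul hs hR hx, pd_mul hs hS (hg.smooth a b) hx, h2]
  rw [cov2, h1, pd_metric hg hx]
  simp only [cov2, schouten, mul_sub, mul_add, Finset.sum_sub_distrib, Finset.mul_sum]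
  simp only [mul_left_comm]
  ring

/-- In terms of J = R/6 this reads ∇ᵃPₐ꜀ = ∇꜀J; the coefficient is 1/4 - 1/12 = 1/6. -/
lemma div_schouten (hs : RegularDomain s) (hg : IsMetricOn s g) (hx : x ∈ s) (c : Fin 4) :
    tr (g x) (fun k a => cov2 s g (schouten s g) x k a c) = pd s c (scalar s g) x / 6 := by
  simp only [cov2_schouten hs hg hx]
  rw [tr_sub, tr_const_mul, div_ricci hs hg hx]
  have h := tr_metric_mul hg hx (fun k => pd s k (scalar s g) x / 12) c
  have h2 : tr (g x) (fun k a => pd s k (scalar s g) x / 12 * g x a c)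
      = pd s c (scalar s g) x / 12 := by
    rw [← h]
    congr 1
    funext k a
    rw [hg.apply_comm hx a c]; ring
  rw [h2]; ring

/-- The Kulkarni-Nomizu type terms of the Weyl decomposition. -/
def metricSchouten (s : Set (Coord 4)) (g : Coord 4 → Matrix (Fin 4) (Fin 4) ℝ) (x : Coord 4)
    (a b c d : Fin 4) : ℝ := g x c a * schouten s g x b d

lemma smooth4_metricSchouten (hs : RegularDomain s) (hg : IsMetricOn s g) :
    Smooth4 s (metricSchouten s g) :=
  fun a b c d => (hg.smooth c a).mul (contDiffOn_schouten hs hg b d)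

lemma smooth4_weyl (hs : RegularDomain s) (hg : IsMetricOn s g) : Smooth4 s (weyl s g) := by
  have h := smooth4_metricSchouten hs hg
  exact fun a b c d => (smooth4_riemann hs hg a b c d).sub
    ((((h a b c d).sub (h b a c d)).add (h b a d c)).sub (h a b d c))

/-- The four metric terms are index permutations of `metricSchouten`, so a single Leibniz
computation serves them all. -/
lemma cov4_weyl (hs : RegularDomain s) (hg : IsMetricOn s g) (hx : x ∈ s) (k a b c d : Fin 4) :
    cov4 s g (weyl s g) x k a b c d = cov4 s g (riemann s g) x k a b c d
      - (g x c a * cov2 s g (schouten s g) x k b d - g x c b * cov2 s g (schouten s g) x k a d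
        + g x d b * cov2 s g (schouten s g) x k a c
        - g x d a * cov2 s g (schouten s g) x k b c) := by
  have h := smooth4_metricSchouten hs hg
  have h1 : Smooth4 s fun y a b c d => metricSchouten s g y b a c d := fun a b c d => h b a c d
  have h2 : Smooth4 s fun y a b c d => metricSchouten s g y b a d c := fun a b c d => h b a d c
  have h3 : Smooth4 s fun y a b c d => metricSchouten s g y a b d c := fun a b c d => h a b d c
  have h4 : ∀ a b c d, cov4 s g (metricSchouten s g) x k a b c d
      = g x c a * cov2 s g (schouten s g) x k b d := fun a b c d =>
    cov4_metric_mul hs hg (contDiffOn_schouten hs hg) hx k a b c d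
  have h01 : Smooth4 s fun y a b c d =>
      metricSchouten s g y a b c d - metricSchouten s g y b a c d :=
    fun a b c d => (h a b c d).sub (h1 a b c d)
  have h02 : Smooth4 s fun y a b c d =>
      metricSchouten s g y a b c d - metricSchouten s g y b a c d + metricSchouten s g y b a d c :=
    fun a b c d => (h01 a b c d).add (h2 a b c d)
  have h03 : Smooth4 s fun y a b c d =>
      metricSchouten s g y a b c d - metricSchouten s g y b a c d + metricSchouten s g y b a d c
        - metricSchouten s g y a b d c :=
    fun a b c d => (h02 a b c d).sub (h3 a b c d)
  have e1 := cov4_swap12 (s := s) (g := g) (x := x) (t := metricSchouten s g) k a b c d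
  have e2 := cov4_swap12 (s := s) (g := g) (x := x)
    (t := fun y a b c d => metricSchouten s g y a b d c) k a b c d
  have e3 := cov4_swap34 (s := s) (g := g) (x := x) (t := metricSchouten s g) k a b c d
  have e4 := cov4_swap34 (s := s) (g := g) (x := x) (t := metricSchouten s g) k b a c d
  have main := cov4_sub (g := g) hs (smooth4_riemann hs hg) h03 hx k a b c d
  rw [cov4_sub hs h02 h3 hx, cov4_add hs h01 h2 hx, cov4_sub hs h h1 hx, e1, e2, e3, e4,
    h4, h4, h4, h4] at main
  exact main

/-- In dimension four the divergence of the Weyl tensor is the Cotton tensor. -/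
lemma div_weyl (hs : RegularDomain s) (hg : IsMetricOn s g) (hx : x ∈ s) (b c d : Fin 4) :
    tr (g x) (fun k a => cov4 s g (weyl s g) x k a b c d) = cotton s g x b c d := by
  simp only [cov4_weyl hs hg hx]
  -- Since ∇Ric = 2∇P + (∇R/6) g, the divergence of Riemann is twice the Cotton tensor plus gradient
  -- terms in R. The Schouten terms remove one Cotton tensor and all of these gradient terms.
  rw [tr_sub, tr_sub, tr_add, tr_sub, div_riemann hs hg hx,
    tr_metric_mul hg hx (fun k => cov2 s g (schouten s g) x k b d),
    tr_metric_mul hg hx (fun k => cov2 s g (schouten s g) x k b c),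
    tr_const_mul, tr_const_mul, div_schouten hs hg hx, div_schouten hs hg hx, cotton,
    cov2_schouten hs hg hx c b d, cov2_schouten hs hg hx d b c, cov2_schouten hs hg hx c d b,
    cov2_schouten hs hg hx d c b]
  have h : ∀ k a b, cov2 s g (ricci s g) x k a b = cov2 s g (ricci s g) x k b a := by
    intro k a b
    simp only [cov2, ricci_comm hs hg hx b]
    rw [pd_congr (fun y hy => ricci_comm hs hg hy a b) hx]
    simp only [ricci_comm hs hg hx _ a]
    ring
  rw [h c d b, h d c b, hg.apply_comm hx d b, hg.apply_comm hx c b]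
  ring

/-! ### Symmetries of the Weyl and Cotton tensors -/

lemma weyl_swap12 (a b c d : Fin 4) : weyl s g x b a c d = - weyl s g x a b c d := by
  simp only [weyl, riemann_swap12 b a]
  rw [riemann_swap12 a b]; ring

lemma weyl_swap34 (hs : RegularDomain s) (hg : IsMetricOn s g) (hx : x ∈ s) (a b c d : Fin 4) :
    weyl s g x a b d c = - weyl s g x a b c d := by
  simp only [weyl]
  rw [riemann_swap34 hs hg hx]; ring

lemma weyl_pair (hs : RegularDomain s) (hg : IsMetricOn s g) (hx : x ∈ s) (a b c d : Fin 4) :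
    weyl s g x c d a b = weyl s g x a b c d := by
  simp only [weyl]
  rw [riemann_pair hs hg hx a b c d, hg.apply_comm hx a c, hg.apply_comm hx a d,
    hg.apply_comm hx b d, hg.apply_comm hx b c, schouten_comm hs hg hx d b,
    schouten_comm hs hg hx c b, schouten_comm hs hg hx c a, schouten_comm hs hg hx d a]
  ring

lemma cotton_swap (a b c : Fin 4) : cotton s g x a c b = - cotton s g x a b c := by
  simp only [cotton]; ring

lemma contDiffOn_cotton (hs : RegularDomain s) (hg : IsMetricOn s g) (a b c : Fin 4) :
    ContDiffOn ℝ ∞ (fun y => cotton s g y a b c) s :=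
  (contDiffOn_cov2 hs hg (contDiffOn_schouten hs hg) b c a).sub
    (contDiffOn_cov2 hs hg (contDiffOn_schouten hs hg) c b a)

lemma cov3_cotton_swap (hs : RegularDomain s) (hx : x ∈ s) (k a b c : Fin 4) :
    cov3 s g (cotton s g) x k a c b = - cov3 s g (cotton s g) x k a b c := by
  simp only [cov3]
  rw [pd_congr (fun y _ => cotton_swap a b c) hx, pd_neg hs hx]
  simp only [cotton_swap _ b, cotton_swap _ _ c, mul_neg, Finset.sum_neg_distrib]
  ring

lemma cov4_weyl_swap12 (hs : RegularDomain s) (hx : x ∈ s) (k a b c d : Fin 4) :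
    cov4 s g (weyl s g) x k b a c d = - cov4 s g (weyl s g) x k a b c d := by
  rw [← cov4_swap12, ← cov4_neg hs hx]
  refine congrFun (congrFun (congrFun (congrFun (congrFun (cov4_congr (fun y hy => ?_) hx)
    k) a) b) c) d
  funext a b c d
  exact weyl_swap12 a b c d

end Curvature

/-! ### Evaluation of tensors on vectors -/

section Evaluation

variable {ι : Type*} (I : Finset ι)

lemma ev1_add (t r X : Fin 4 → ℝ) : ev1 (fun a => t a + r a) X = ev1 t X + ev1 r X := by
  simp [ev1, add_mul, Finset.sum_add_distrib]

lemma ev1_sub (t r X : Fin 4 → ℝ) : ev1 (fun a => t a - r a) X = ev1 t X - ev1 r X := by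
  simp [ev1, sub_mul, Finset.sum_sub_distrib]

lemma ev1_neg (t X : Fin 4 → ℝ) : ev1 (fun a => - t a) X = - ev1 t X := by
  simp [ev1]

lemma ev1_mul (c : ℝ) (t X : Fin 4 → ℝ) : ev1 (fun a => c * t a) X = c * ev1 t X := by
  simp [ev1, Finset.mul_sum, mul_assoc]

lemma ev1_mul_right (c : ℝ) (t X : Fin 4 → ℝ) : ev1 (fun a => t a * c) X = ev1 t X * c := by
  simp only [ev1, Finset.sum_mul]
  exact Finset.sum_congr rfl fun _ _ => by ring

lemma ev1_sum (t : ι → Fin 4 → ℝ) (X : Fin 4 → ℝ) :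
    ev1 (fun a => ∑ l ∈ I, t l a) X = ∑ l ∈ I, ev1 (t l) X := by
  simp only [ev1, Finset.sum_mul]
  exact Finset.sum_comm

lemma ev1_vec_add (t X Y : Fin 4 → ℝ) : ev1 t (fun a => X a + Y a) = ev1 t X + ev1 t Y := by
  simp [ev1, mul_add, Finset.sum_add_distrib]

lemma ev1_vec_mul (c : ℝ) (t X : Fin 4 → ℝ) : ev1 t (fun a => c * X a) = c * ev1 t X := by
  simp [ev1, Finset.mul_sum, mul_left_comm]

lemma ev1_vec_sum (t : Fin 4 → ℝ) (X : ι → Fin 4 → ℝ) :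
    ev1 t (fun a => ∑ l ∈ I, X l a) = ∑ l ∈ I, ev1 t (X l) := by
  simp only [ev1, Finset.mul_sum]
  exact Finset.sum_comm

lemma ev1_comm (t : Fin 4 → Fin 4 → ℝ) (X Y : Fin 4 → ℝ) :
    ev1 (fun a => ev1 (fun b => t a b) Y) X = ev1 (fun b => ev1 (fun a => t a b) X) Y := by
  simp only [ev1, Finset.sum_mul]
  rw [Finset.sum_comm]
  exact Finset.sum_congr rfl fun _ _ => Finset.sum_congr rfl fun _ _ => by ring

lemma ev2_swap (t : Fin 4 → Fin 4 → ℝ) (X Y : Fin 4 → ℝ) :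
    ev2 (fun a b => t b a) X Y = ev2 t Y X := by
  simp only [ev2]; rw [ev1_comm]

lemma ev2_comm (t : Fin 4 → Fin 4 → Fin 4 → Fin 4 → ℝ) (X Y Z W : Fin 4 → ℝ) :
    ev2 (fun a b => ev2 (fun c d => t a b c d) Z W) X Y
      = ev2 (fun c d => ev2 (fun a b => t a b c d) X Y) Z W := by
  simp only [ev2]
  calc _ = ev1 (fun a => ev1 (fun c => ev1 (fun b => ev1 (fun d => t a b c d) W) Y) Z) X := by
        congr 1; funext a; rw [ev1_comm]
    _ = ev1 (fun c => ev1 (fun a => ev1 (fun d => ev1 (fun b => t a b c d) Y) W) X) Z := by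
        rw [ev1_comm]; congr 1; funext c; congr 1; funext a; rw [ev1_comm]
    _ = _ := by congr 1; funext c; rw [ev1_comm]

lemma ev4_pair {t : Fin 4 → Fin 4 → Fin 4 → Fin 4 → ℝ} (h : ∀ a b c d, t c d a b = t a b c d)
    (X Y Z W : Fin 4 → ℝ) : ev4 t Z W X Y = ev4 t X Y Z W := by
  have h1 : t = fun a b c d => t c d a b := by funext a b c d; rw [h]
  conv_rhs => rw [h1]
  exact (ev2_comm (fun a b c d => t c d a b) X Y Z W).symm

lemma ev4_swap12 {t : Fin 4 → Fin 4 → Fin 4 → Fin 4 → ℝ} (h : ∀ a b c d, t b a c d = - t a b c d)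
    (X Y Z W : Fin 4 → ℝ) : ev4 t Y X Z W = - ev4 t X Y Z W := by
  have h1 : (fun a b => ev2 (t b a) Z W) = fun a b => - ev2 (t a b) Z W := by
    funext a b
    have : t b a = fun c d => - t a b c d := by funext c d; exact h a b c d
    rw [this]; simp only [ev2, ev1_neg]
  have h2 := ev2_swap (fun a b => ev2 (t a b) Z W) X Y
  rw [h1] at h2
  simp only [ev2, ev1_neg] at h2
  exact h2.symm

lemma ev2_antisymm {t : Fin 4 → Fin 4 → ℝ} (h : ∀ a b, t b a = - t a b) (X Y : Fin 4 → ℝ) :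
    ev2 t Y X = - ev2 t X Y := by
  have h1 : (fun a b => t b a) = fun a b => - t a b := by funext a b; exact h a b
  rw [← ev2_swap, h1]
  simp only [ev2, ev1_neg]

lemma ev4_swap34 {t : Fin 4 → Fin 4 → Fin 4 → Fin 4 → ℝ} (h : ∀ a b c d, t a b d c = - t a b c d)
    (X Y Z W : Fin 4 → ℝ) : ev4 t X Y W Z = - ev4 t X Y Z W := by
  have h1 : ∀ a b, ev2 (t a b) W Z = - ev2 (t a b) Z W := fun a b => ev2_antisymm (h a b) Z W
  change ev2 (fun a b => ev2 (t a b) W Z) X Y = - ev2 (fun a b => ev2 (t a b) Z W) X Y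
  simp only [h1]
  simp only [ev2, ev1_neg]

lemma ev3_swap {t : Fin 4 → Fin 4 → Fin 4 → ℝ} (h : ∀ a b c, t a c b = - t a b c)
    (X Y Z : Fin 4 → ℝ) : ev3 t X Z Y = - ev3 t X Y Z := by
  have h1 : ∀ a, ev2 (t a) Z Y = - ev2 (t a) Y Z := fun a => ev2_antisymm (h a) Y Z
  simp only [ev3, h1, ev1_neg]

lemma ev1_ev2 (t : Fin 4 → Fin 4 → Fin 4 → ℝ) (X Y e : Fin 4 → ℝ) :
    ev1 (fun k => ev2 (t k) X Y) e = ev2 (fun a b => ev1 (fun k => t k a b) e) X Y := by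
  simp only [ev2]
  rw [ev1_comm]
  congr 1; funext a
  rw [ev1_comm]

lemma ev1_ev3 (t : Fin 4 → Fin 4 → Fin 4 → Fin 4 → ℝ) (X Y Z e : Fin 4 → ℝ) :
    ev1 (fun k => ev3 (t k) X Y Z) e = ev3 (fun a b c => ev1 (fun k => t k a b c) e) X Y Z := by
  simp only [ev3]
  rw [ev1_comm]
  congr 1; funext a
  rw [ev1_ev2]

lemma ev1_ev4 (t : Fin 4 → Fin 4 → Fin 4 → Fin 4 → Fin 4 → ℝ) (X Y Z W e : Fin 4 → ℝ) :
    ev1 (fun k => ev4 (t k) X Y Z W) e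
      = ev4 (fun a b c d => ev1 (fun k => t k a b c d) e) X Y Z W := by
  simp only [ev4]
  rw [ev1_comm]
  congr 1; funext a
  rw [ev1_ev3]

lemma tr_ev1 (G : Matrix (Fin 4) (Fin 4) ℝ) (t : Fin 4 → Fin 4 → Fin 4 → ℝ) (X : Fin 4 → ℝ) :
    ev1 (fun c => tr G fun a b => t a b c) X = tr G fun a b => ev1 (t a b) X := by
  simp only [tr, ev1_sum, ev1_mul]

/-- The Leibniz expansion, along a surface, of a tensor evaluated on vector fields. Here `γ` are the
components of an arbitrary connection in the direction of differentiation. -/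
lemma pd_ev1 {V : Set (Coord 3)} {u : Coord 3} (hV : RegularDomain V) (hu : u ∈ V) (i : Fin 3)
    (γ : Fin 4 → Fin 4 → ℝ) {t : Coord 3 → Fin 4 → ℝ} {X : Coord 3 → Fin 4 → ℝ}
    (ht : ∀ a, ContDiffOn ℝ ∞ (fun w => t w a) V) (hX : ∀ a, ContDiffOn ℝ ∞ (fun w => X w a) V) :
    pd V i (fun w => ev1 (t w) (X w)) u
      = ev1 (fun a => pd V i (fun w => t w a) u - ∑ l, γ l a * t u l) (X u)
        + ev1 (t u) (fun a => pd V i (fun w => X w a) u + ∑ l, γ a l * X u l) := by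
  have h1 : pd V i (fun w => ev1 (t w) (X w)) u
      = ev1 (fun a => pd V i (fun w => t w a) u) (X u)
        + ev1 (t u) (fun a => pd V i (fun w => X w a) u) := by
    simp only [ev1]
    rw [pd_sum _ hV (fun a => (ht a).mul (hX a)) hu, ← Finset.sum_add_distrib]
    exact Finset.sum_congr rfl fun a _ => pd_mul hV (ht a) (hX a) hu
  -- The connection terms on the covector and on the vector are dual to each other, so any γ may be
  -- inserted.
  have h2 : ev1 (fun a => ∑ l, γ l a * t u l) (X u) = ev1 (t u) (fun a => ∑ l, γ a l * X u l) := by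
    simp only [ev1, Finset.sum_mul, Finset.mul_sum]
    rw [Finset.sum_comm]
    exact Finset.sum_congr rfl fun _ _ => Finset.sum_congr rfl fun _ _ => by ring
  rw [h1, ev1_sub, ev1_vec_add, h2]; ring

lemma contDiffOn_ev1 {V : Set (Coord 3)} {t : Coord 3 → Fin 4 → ℝ} {X : Coord 3 → Fin 4 → ℝ}
    (ht : ∀ a, ContDiffOn ℝ ∞ (fun w => t w a) V) (hX : ∀ a, ContDiffOn ℝ ∞ (fun w => X w a) V) :
    ContDiffOn ℝ ∞ (fun w => ev1 (t w) (X w)) V :=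
  ContDiffOn.sum fun a _ => (ht a).mul (hX a)

lemma contDiffOn_ev2 {V : Set (Coord 3)} {t : Coord 3 → Fin 4 → Fin 4 → ℝ}
    {X Y : Coord 3 → Fin 4 → ℝ} (ht : ∀ a b, ContDiffOn ℝ ∞ (fun w => t w a b) V)
    (hX : ∀ a, ContDiffOn ℝ ∞ (fun w => X w a) V) (hY : ∀ a, ContDiffOn ℝ ∞ (fun w => Y w a) V) :
    ContDiffOn ℝ ∞ (fun w => ev2 (t w) (X w) (Y w)) V :=
  contDiffOn_ev1 (fun a => contDiffOn_ev1 (ht a) hY) hX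

lemma contDiffOn_ev3 {V : Set (Coord 3)} {t : Coord 3 → Fin 4 → Fin 4 → Fin 4 → ℝ}
    {X Y Z : Coord 3 → Fin 4 → ℝ} (ht : ∀ a b c, ContDiffOn ℝ ∞ (fun w => t w a b c) V)
    (hX : ∀ a, ContDiffOn ℝ ∞ (fun w => X w a) V) (hY : ∀ a, ContDiffOn ℝ ∞ (fun w => Y w a) V)
    (hZ : ∀ a, ContDiffOn ℝ ∞ (fun w => Z w a) V) :
    ContDiffOn ℝ ∞ (fun w => ev3 (t w) (X w) (Y w) (Z w)) V :=
  contDiffOn_ev1 (fun a => contDiffOn_ev2 (ht a) hY hZ) hX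

lemma contDiffOn_ev4 {V : Set (Coord 3)} {t : Coord 3 → Fin 4 → Fin 4 → Fin 4 → Fin 4 → ℝ}
    {X Y Z W : Coord 3 → Fin 4 → ℝ} (ht : ∀ a b c d, ContDiffOn ℝ ∞ (fun w => t w a b c d) V)
    (hX : ∀ a, ContDiffOn ℝ ∞ (fun w => X w a) V) (hY : ∀ a, ContDiffOn ℝ ∞ (fun w => Y w a) V)
    (hZ : ∀ a, ContDiffOn ℝ ∞ (fun w => Z w a) V) (hW : ∀ a, ContDiffOn ℝ ∞ (fun w => W w a) V) :
    ContDiffOn ℝ ∞ (fun w => ev4 (t w) (X w) (Y w) (Z w) (W w)) V :=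
  contDiffOn_ev1 (fun a => contDiffOn_ev3 (ht a) hY hZ hW) hX

variable {V : Set (Coord 3)} {u : Coord 3} {X Y Z W : Coord 3 → Fin 4 → ℝ}

lemma pd_ev2 (hV : RegularDomain V) (hu : u ∈ V) (i : Fin 3)
    (γ : Fin 4 → Fin 4 → ℝ) {t : Coord 3 → Fin 4 → Fin 4 → ℝ}
    (ht : ∀ a b, ContDiffOn ℝ ∞ (fun w => t w a b) V)
    (hX : ∀ a, ContDiffOn ℝ ∞ (fun w => X w a) V) (hY : ∀ a, ContDiffOn ℝ ∞ (fun w => Y w a) V) :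
    pd V i (fun w => ev2 (t w) (X w) (Y w)) u
      = ev2 (fun a b => pd V i (fun w => t w a b) u - ∑ l, γ l a * t u l b
          - ∑ l, γ l b * t u a l) (X u) (Y u)
        + ev2 (t u) (fun a => pd V i (fun w => X w a) u + ∑ l, γ a l * X u l) (Y u)
        + ev2 (t u) (X u) (fun a => pd V i (fun w => Y w a) u + ∑ l, γ a l * Y u l) := by
  simp only [ev2]
  rw [pd_ev1 hV hu i γ (fun a => contDiffOn_ev1 (ht a) hY) hX]
  simp only [pd_ev1 hV hu i γ (ht _) hY, ev1_sub, ev1_add, ev1_sum, ev1_mul]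
  ring

lemma pd_ev3 (hV : RegularDomain V) (hu : u ∈ V) (i : Fin 3)
    (γ : Fin 4 → Fin 4 → ℝ) {t : Coord 3 → Fin 4 → Fin 4 → Fin 4 → ℝ}
    (ht : ∀ a b c, ContDiffOn ℝ ∞ (fun w => t w a b c) V)
    (hX : ∀ a, ContDiffOn ℝ ∞ (fun w => X w a) V) (hY : ∀ a, ContDiffOn ℝ ∞ (fun w => Y w a) V)
    (hZ : ∀ a, ContDiffOn ℝ ∞ (fun w => Z w a) V) :
    pd V i (fun w => ev3 (t w) (X w) (Y w) (Z w)) u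
      = ev3 (fun a b c => pd V i (fun w => t w a b c) u - ∑ l, γ l a * t u l b c
          - ∑ l, γ l b * t u a l c - ∑ l, γ l c * t u a b l) (X u) (Y u) (Z u)
        + ev3 (t u) (fun a => pd V i (fun w => X w a) u + ∑ l, γ a l * X u l) (Y u) (Z u)
        + ev3 (t u) (X u) (fun a => pd V i (fun w => Y w a) u + ∑ l, γ a l * Y u l) (Z u)
        + ev3 (t u) (X u) (Y u) (fun a => pd V i (fun w => Z w a) u + ∑ l, γ a l * Z u l) := by
  simp only [ev3]
  rw [pd_ev1 (t := fun w a => ev2 (t w a) (Y w) (Z w)) hV hu i γ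
    (fun a => contDiffOn_ev2 (ht a) hY hZ) hX]
  have h := fun a => pd_ev2 (t := fun w => t w a) hV hu i γ (ht a) hY hZ
  simp only [h]
  simp only [ev2, ev1_sub, ev1_add, ev1_sum, ev1_mul]
  ring

lemma pd_ev4 (hV : RegularDomain V) (hu : u ∈ V) (i : Fin 3)
    (γ : Fin 4 → Fin 4 → ℝ) {t : Coord 3 → Fin 4 → Fin 4 → Fin 4 → Fin 4 → ℝ}
    (ht : ∀ a b c d, ContDiffOn ℝ ∞ (fun w => t w a b c d) V)
    (hX : ∀ a, ContDiffOn ℝ ∞ (fun w => X w a) V) (hY : ∀ a, ContDiffOn ℝ ∞ (fun w => Y w a) V)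
    (hZ : ∀ a, ContDiffOn ℝ ∞ (fun w => Z w a) V) (hW : ∀ a, ContDiffOn ℝ ∞ (fun w => W w a) V) :
    pd V i (fun w => ev4 (t w) (X w) (Y w) (Z w) (W w)) u
      = ev4 (fun a b c d => pd V i (fun w => t w a b c d) u - ∑ l, γ l a * t u l b c d
          - ∑ l, γ l b * t u a l c d - ∑ l, γ l c * t u a b l d - ∑ l, γ l d * t u a b c l)
          (X u) (Y u) (Z u) (W u)
        + ev4 (t u) (fun a => pd V i (fun w => X w a) u + ∑ l, γ a l * X u l) (Y u) (Z u) (W u)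
        + ev4 (t u) (X u) (fun a => pd V i (fun w => Y w a) u + ∑ l, γ a l * Y u l) (Z u) (W u)
        + ev4 (t u) (X u) (Y u) (fun a => pd V i (fun w => Z w a) u + ∑ l, γ a l * Z u l) (W u)
        + ev4 (t u) (X u) (Y u) (Z u) (fun a => pd V i (fun w => W w a) u + ∑ l, γ a l * W u l) := by
  simp only [ev4]
  rw [pd_ev1 (t := fun w a => ev3 (t w a) (Y w) (Z w) (W w)) hV hu i γ
    (fun a => contDiffOn_ev3 (ht a) hY hZ hW) hX]
  have h := fun a => pd_ev3 (t := fun w => t w a) hV hu i γ (ht a) hY hZ hW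
  simp only [h]
  simp only [ev3, ev2, ev1_sub, ev1_add, ev1_sum, ev1_mul]
  ring

end Evaluation

/-! ### Covariant differentiation along a parametrized hypersurface -/

/-- A parametrized spacelike hypersurface with unit normal `N`. -/
structure IsSpacelike (s : Set (Coord 4)) (g : Coord 4 → Matrix (Fin 4) (Fin 4) ℝ)
    (V : Set (Coord 3)) (φ : Coord 3 → Coord 4) (N : Coord 3 → Fin 4 → ℝ) : Prop where
  regular : RegularDomain s
  metric : IsMetricOn s g
  regular_param : RegularDomain V
  contDiffOn : ContDiffOn ℝ ∞ φ V
  mapsTo : MapsTo φ V s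
  unitNormal : IsUnitNormal g V φ N
  det_ne_zero : ∀ u ∈ V, (indMetric g V φ u).det ≠ 0

/-- The covariant derivative `∇_{∂ᵢφ} X` of a vector field along the hypersurface. -/
def covAlong (s : Set (Coord 4)) (g : Coord 4 → Matrix (Fin 4) (Fin 4) ℝ) (V : Set (Coord 3))
    (φ : Coord 3 → Coord 4) (X : Coord 3 → Fin 4 → ℝ) (u : Coord 3) (i : Fin 3) (a : Fin 4) : ℝ :=
  pd V i (fun w => X w a) u + ∑ c, ∑ d, christoffel s g (φ u) a c d * tang V φ u i c * X u d

section Along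

variable {s : Set (Coord 4)} {g : Coord 4 → Matrix (Fin 4) (Fin 4) ℝ}
  {V : Set (Coord 3)} {φ : Coord 3 → Coord 4} {u : Coord 3} {X Y Z W : Coord 3 → Fin 4 → ℝ}

lemma covAlong_eq (i : Fin 3) : covAlong s g V φ X u i = fun a =>
    pd V i (fun w => X w a) u
      + ∑ l, (∑ c, tang V φ u i c * christoffel s g (φ u) a c l) * X u l := by
  funext a
  rw [covAlong, Finset.sum_comm]
  congr 1
  refine Finset.sum_congr rfl fun l _ => ?_
  rw [Finset.sum_mul]
  exact Finset.sum_congr rfl fun c _ => by ring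

lemma contDiffOn_tang (hV : RegularDomain V) (hφ : ContDiffOn ℝ ∞ φ V) (i : Fin 3) (a : Fin 4) :
    ContDiffOn ℝ ∞ (fun w => tang V φ w i a) V := contDiffOn_pd hV (contDiffOn_coord hφ a)

/-- Identifies the connection contracted with a direction e as the coefficients γ of the preceding
Leibniz rules. -/
lemma ev1_conn (e q : Fin 4 → ℝ) (x : Coord 4) (a : Fin 4) :
    ev1 (fun k => ∑ l, christoffel s g x l k a * q l) e
      = ∑ l, (∑ c, e c * christoffel s g x l c a) * q l := by
  rw [ev1_sum]
  refine Finset.sum_congr rfl fun l _ => ?_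
  rw [ev1_mul_right, ev1]
  congr 1
  exact Finset.sum_congr rfl fun _ _ => mul_comm _ _

variable (hV : RegularDomain V)
  (hφ : ContDiffOn ℝ ∞ φ V) (hm : MapsTo φ V s) (hu : u ∈ V) (i : Fin 3)
  (hX : ∀ a, ContDiffOn ℝ ∞ (fun w => X w a) V) (hY : ∀ a, ContDiffOn ℝ ∞ (fun w => Y w a) V)
  (hZ : ∀ a, ContDiffOn ℝ ∞ (fun w => Z w a) V) (hW : ∀ a, ContDiffOn ℝ ∞ (fun w => W w a) V)

include hV hφ hm hu

lemma ev1_pd_tang {f : Coord 4 → ℝ} (hf : ContDiffOn ℝ ∞ f s) :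
    ev1 (fun k => pd s k f (φ u)) (tang V φ u i) = pd V i (fun w => f (φ w)) u := by
  rw [pd_comp hV hf hφ hm hu]
  exact Finset.sum_congr rfl fun _ _ => mul_comm _ _

include hX hY

/-- The Leibniz rule for the pulled-back connection. It recovers a tangential covariant derivative
of a spacetime tensor from components known only on the hypersurface. -/
lemma pd_ev2_along {t : Coord 4 → Fin 4 → Fin 4 → ℝ}
    (ht : ∀ a b, ContDiffOn ℝ ∞ (fun y => t y a b) s) :
    pd V i (fun w => ev2 (t (φ w)) (X w) (Y w)) u
      = ev1 (fun k => ev2 (cov2 s g t (φ u) k) (X u) (Y u)) (tang V φ u i)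
        + ev2 (t (φ u)) (covAlong s g V φ X u i) (Y u)
        + ev2 (t (φ u)) (X u) (covAlong s g V φ Y u i) := by
  rw [covAlong_eq, covAlong_eq, pd_ev2 (t := fun w => t (φ w)) hV hu i
    (fun l a => ∑ c, tang V φ u i c * christoffel s g (φ u) l c a)
    (fun a b => (ht a b).comp hφ hm) hX hY, ev1_ev2]
  simp only [cov2, ev1_sub, ev1_conn, ev1_pd_tang hV hφ hm hu i (ht _ _)]

include hZ

lemma pd_ev3_along {t : Coord 4 → Fin 4 → Fin 4 → Fin 4 → ℝ}
    (ht : ∀ a b c, ContDiffOn ℝ ∞ (fun y => t y a b c) s) :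
    pd V i (fun w => ev3 (t (φ w)) (X w) (Y w) (Z w)) u
      = ev1 (fun k => ev3 (cov3 s g t (φ u) k) (X u) (Y u) (Z u)) (tang V φ u i)
        + ev3 (t (φ u)) (covAlong s g V φ X u i) (Y u) (Z u)
        + ev3 (t (φ u)) (X u) (covAlong s g V φ Y u i) (Z u)
        + ev3 (t (φ u)) (X u) (Y u) (covAlong s g V φ Z u i) := by
  rw [covAlong_eq, covAlong_eq, covAlong_eq, pd_ev3 (t := fun w => t (φ w)) hV hu i
    (fun l a => ∑ c, tang V φ u i c * christoffel s g (φ u) l c a)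
    (fun a b c => (ht a b c).comp hφ hm) hX hY hZ, ev1_ev3]
  simp only [cov3, ev1_sub, ev1_conn, ev1_pd_tang hV hφ hm hu i (ht _ _ _)]

include hW

lemma pd_ev4_along {t : Coord 4 → Fin 4 → Fin 4 → Fin 4 → Fin 4 → ℝ} (ht : Smooth4 s t) :
    pd V i (fun w => ev4 (t (φ w)) (X w) (Y w) (Z w) (W w)) u
      = ev1 (fun k => ev4 (cov4 s g t (φ u) k) (X u) (Y u) (Z u) (W u)) (tang V φ u i)
        + ev4 (t (φ u)) (covAlong s g V φ X u i) (Y u) (Z u) (W u)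
        + ev4 (t (φ u)) (X u) (covAlong s g V φ Y u i) (Z u) (W u)
        + ev4 (t (φ u)) (X u) (Y u) (covAlong s g V φ Z u i) (W u)
        + ev4 (t (φ u)) (X u) (Y u) (Z u) (covAlong s g V φ W u i) := by
  rw [covAlong_eq, covAlong_eq, covAlong_eq, covAlong_eq,
    pd_ev4 (t := fun w => t (φ w)) hV hu i
    (fun l a => ∑ c, tang V φ u i c * christoffel s g (φ u) l c a)
    (fun a b c d => (ht a b c d).comp hφ hm) hX hY hZ hW, ev1_ev4]
  simp only [cov4, ev1_sub, ev1_conn, ev1_pd_tang hV hφ hm hu i (ht _ _ _ _)]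

end Along

/-! ### The adapted frame of a hypersurface: Gauss and Weingarten formulas -/

lemma ev2_comm_of_symm {G : Matrix (Fin 4) (Fin 4) ℝ} (hG : ∀ a b, G a b = G b a)
    (X Y : Fin 4 → ℝ) : ev2 G X Y = ev2 G Y X := by
  calc ev2 G X Y = ev2 (fun a b => G b a) Y X := (ev2_swap (fun a b => G a b) Y X).symm
    _ = ev2 G Y X := by congr 1; funext a b; exact hG b a

namespace IsSpacelike

variable {s : Set (Coord 4)} {g : Coord 4 → Matrix (Fin 4) (Fin 4) ℝ}
  {V : Set (Coord 3)} {φ : Coord 3 → Coord 4} {N : Coord 3 → Fin 4 → ℝ} {u : Coord 3}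
  (H : IsSpacelike s g V φ N) (hu : u ∈ V)
include H

lemma contDiffOn_tang (i : Fin 3) (a : Fin 4) : ContDiffOn ℝ ∞ (fun w => tang V φ w i a) V :=
  BachConstraint.contDiffOn_tang H.regular_param H.contDiffOn i a

lemma contDiffOn_normal (a : Fin 4) : ContDiffOn ℝ ∞ (fun w => N w a) V :=
  contDiffOn_pi.1 H.unitNormal.contDiffOn a

lemma contDiffOn_comp {f : Coord 4 → ℝ} (hf : ContDiffOn ℝ ∞ f s) :
    ContDiffOn ℝ ∞ (fun w => f (φ w)) V := hf.comp H.contDiffOn H.mapsTo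

lemma isMetricOn_indMetric : IsMetricOn V (indMetric g V φ) where
  smooth i j := contDiffOn_ev2 (t := fun w => g (φ w))
    (fun a b => H.contDiffOn_comp (H.metric.smooth a b)) (H.contDiffOn_tang i) (H.contDiffOn_tang j)
  symm u hu := by
    ext i j
    exact ev2_comm_of_symm (H.metric.apply_comm (H.mapsTo hu)) _ _
  det_ne_zero := H.det_ne_zero

include hu

lemma metric_symm (X Y : Fin 4 → ℝ) : ev2 (g (φ u)) X Y = ev2 (g (φ u)) Y X :=
  ev2_comm_of_symm (H.metric.apply_comm (H.mapsTo hu)) _ _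

/-- The inverse metric in terms of the adapted frame. -/
lemma metric_inv (a b : Fin 4) : (g (φ u))⁻¹ a b =
    (∑ i, ∑ j, (indMetric g V φ u)⁻¹ i j * (tang V φ u i a * tang V φ u j b))
      - N u a * N u b := by
  set h := indMetric g V φ u with hh
  set G := g (φ u) with hG
  -- The columns of M are the frame vectors; the Gram matrix MᵀGM is the block matrix with blocks -1
  -- and h, so G⁻¹ = M D' Mᵀ.
  let M : Matrix (Fin 4) (Unit ⊕ Fin 3) ℝ :=
    Matrix.of fun a p => Sum.elim (fun _ => N u a) (fun i => tang V φ u i a) p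
  have hN := H.unitNormal.unit u hu
  have hT := H.unitNormal.normal u hu
  let D : Matrix (Unit ⊕ Fin 3) (Unit ⊕ Fin 3) ℝ := Matrix.fromBlocks (-1) 0 0 h
  let D' : Matrix (Unit ⊕ Fin 3) (Unit ⊕ Fin 3) ℝ := Matrix.fromBlocks (-1) 0 0 h⁻¹
  have hmul : ∀ p q, (M.transpose * (G * M)) p q = ev2 G (fun a => M a p) (fun a => M a q) := by
    intro p q
    simp only [ev2, ev1, Matrix.mul_apply, Matrix.transpose_apply]
    exact Finset.sum_congr rfl fun a _ => mul_comm _ _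
  have h1 : M.transpose * (G * M) = D := by
    ext p q
    rw [hmul]
    rcases p with p | p <;> rcases q with q | q
    · simpa [M, D] using hN
    · simpa [M, D] using hT q
    · simpa [M, D] using (H.metric_symm hu _ _).trans (hT p)
    · simp [M, D, hh, indMetric, hG]
  have h2 : D' * D = 1 := by
    have : h⁻¹ * h = 1 := Matrix.nonsing_inv_mul _ (H.det_ne_zero u hu).isUnit
    simp [D, D', Matrix.fromBlocks_multiply, this]
  -- Equal cardinality of the two index types turns the left inverse of M into a right inverse.
  have e : Unit ⊕ Fin 3 ≃ Fin 4 := Fintype.equivOfCardEq (by simp)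
  have h3 : (D' * M.transpose * G) * M = 1 := by
    rw [Matrix.mul_assoc, Matrix.mul_assoc, h1, h2]
  have h4 : (M * D' * M.transpose) * G = 1 := by
    rw [Matrix.mul_eq_one_comm_of_equiv e] at h3
    simpa [Matrix.mul_assoc] using h3
  rw [Matrix.inv_eq_left_inv h4]
  simp only [Matrix.mul_apply, Fintype.sum_sum_type, Matrix.transpose_apply]
  simp only [M, D', Matrix.of_apply, Matrix.fromBlocks_apply₁₁, Matrix.fromBlocks_apply₁₂,
    Matrix.fromBlocks_apply₂₁, Matrix.fromBlocks_apply₂₂, Sum.elim_inl, Sum.elim_inr]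
  simp only [Finset.univ_unique, Finset.sum_singleton, Matrix.neg_apply, Matrix.one_apply_eq,
    Matrix.zero_apply, mul_zero, Finset.sum_const_zero, zero_add, add_zero, Finset.sum_mul]
  rw [Finset.sum_comm]
  have h5 : ∀ i j, tang V φ u i a * h⁻¹ i j * tang V φ u j b
      = h⁻¹ i j * (tang V φ u i a * tang V φ u j b) := fun i j => by ring
  simp only [h5]
  ring

/-- The spacetime trace in terms of the adapted frame. -/
lemma tr_eq (t : Fin 4 → Fin 4 → ℝ) : tr (g (φ u)) t =
    tr (indMetric g V φ u) (fun i j => ev2 t (tang V φ u i) (tang V φ u j))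
      - ev2 t (N u) (N u) := by
  have h1 : ∀ X Y : Fin 4 → ℝ, ev2 t X Y = ∑ a, ∑ b, (X a * Y b) * t a b := fun X Y => by
    simp only [ev2, ev1, Finset.sum_mul]
    exact Finset.sum_congr rfl fun _ _ => Finset.sum_congr rfl fun _ _ => by ring
  simp only [h1]
  rw [tr]
  simp only [H.metric_inv hu, sub_mul, Finset.sum_sub_distrib]
  congr 1
  simp only [tr, Finset.mul_sum, Finset.sum_mul]
  calc _ = ∑ a, ∑ i, ∑ b, ∑ j, (indMetric g V φ u)⁻¹ i j
        * (tang V φ u i a * tang V φ u j b) * t a b :=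
        Finset.sum_congr rfl fun a _ => Finset.sum_comm
    _ = ∑ i, ∑ a, ∑ j, ∑ b, (indMetric g V φ u)⁻¹ i j
        * (tang V φ u i a * tang V φ u j b) * t a b := by
        rw [Finset.sum_comm]
        exact Finset.sum_congr rfl fun i _ => Finset.sum_congr rfl fun a _ => Finset.sum_comm
    _ = _ := by
        refine Finset.sum_congr rfl fun i _ => ?_
        rw [Finset.sum_comm]
        exact Finset.sum_congr rfl fun j _ => Finset.sum_congr rfl fun a _ =>
          Finset.sum_congr rfl fun b _ => by ring

/-- The expansion of a vector in the adapted frame. -/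
lemma expand (X : Fin 4 → ℝ) (a : Fin 4) : X a =
    (∑ i, (∑ j, (indMetric g V φ u)⁻¹ i j * ev2 (g (φ u)) X (tang V φ u j)) * tang V φ u i a)
      + -ev2 (g (φ u)) X (N u) * N u a := by
  have h1 := Matrix.nonsing_inv_mul (g (φ u)) (H.metric.isUnit_det (H.mapsTo hu))
  have h2 : X a = ∑ b, (g (φ u))⁻¹ a b * ∑ c, g (φ u) b c * X c := by
    have : ((g (φ u))⁻¹ * g (φ u)).mulVec X a = X a := by rw [h1, Matrix.one_mulVec]
    rw [← this, ← Matrix.mulVec_mulVec]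
    rfl
  have h3 : ∀ Y, ev2 (g (φ u)) X Y = ∑ b, Y b * ∑ c, g (φ u) b c * X c := fun Y => by
    rw [H.metric_symm hu]
    simp only [ev2, ev1]
    exact Finset.sum_congr rfl fun b _ => mul_comm _ _
  rw [h2]
  simp only [H.metric_inv hu, h3, sub_mul, Finset.sum_sub_distrib]
  set q : Fin 4 → ℝ := fun b => ∑ c, g (φ u) b c * X c
  have h4 : ∑ b, N u a * N u b * q b = N u a * ∑ b, N u b * q b := by
    rw [Finset.mul_sum]; exact Finset.sum_congr rfl fun _ _ => by ring
  rw [h4]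
  have h5 : ∑ b, (∑ i, ∑ j, (indMetric g V φ u)⁻¹ i j * (tang V φ u i a * tang V φ u j b)) * q b
      = ∑ i, (∑ j, (indMetric g V φ u)⁻¹ i j * ∑ b, tang V φ u j b * q b) * tang V φ u i a := by
    simp only [Finset.mul_sum, Finset.sum_mul]
    rw [Finset.sum_comm]
    refine Finset.sum_congr rfl fun i _ => ?_
    rw [Finset.sum_comm]
    exact Finset.sum_congr rfl fun j _ => Finset.sum_congr rfl fun b _ => by ring
  rw [h5]
  ring

lemma pd_metric_along {X Y : Coord 3 → Fin 4 → ℝ}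
    (hX : ∀ a, ContDiffOn ℝ ∞ (fun w => X w a) V) (hY : ∀ a, ContDiffOn ℝ ∞ (fun w => Y w a) V)
    (i : Fin 3) : pd V i (fun w => ev2 (g (φ w)) (X w) (Y w)) u
      = ev2 (g (φ u)) (covAlong s g V φ X u i) (Y u)
        + ev2 (g (φ u)) (X u) (covAlong s g V φ Y u i) := by
  have h := pd_ev2_along (g := g) H.regular_param H.contDiffOn H.mapsTo hu i hX hY
    (t := fun y a b => g y a b) H.metric.smooth
  have h0 : ∀ k, cov2 s g (fun y a b => g y a b) (φ u) k = fun _ _ => 0 := fun k => by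
    funext a b; exact cov2_metric H.metric (H.mapsTo hu) k a b
  simp only [h0] at h
  have h1 : ev1 (fun _ => ev2 (fun _ _ => (0 : ℝ)) (X u) (Y u)) (tang V φ u i) = 0 := by
    simp [ev1, ev2]
  rw [h1, zero_add] at h
  exact h

/-- Torsion-freeness together with the commuting of the coordinate fields ∂ᵢφ and ∂ⱼφ. -/
lemma covAlong_tang_comm (i j : Fin 3) :
    covAlong s g V φ (fun w => tang V φ w j) u i = covAlong s g V φ (fun w => tang V φ w i) u j := by
  funext a
  have h1 := pd_comm (i := i) (j := j) H.regular_param (contDiffOn_coord H.contDiffOn a) hu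
  have h2 : pd V i (fun w => tang V φ w j a) u = pd V j (fun w => tang V φ w i a) u := h1
  rw [covAlong, covAlong, h2, Finset.sum_comm]
  congr 1
  exact Finset.sum_congr rfl fun c _ => Finset.sum_congr rfl fun d _ => by
    rw [christoffel_comm H.metric (H.mapsTo hu)]; ring

lemma covAlong_normal_normal (i : Fin 3) :
    ev2 (g (φ u)) (covAlong s g V φ N u i) (N u) = 0 := by
  have h1 := H.pd_metric_along hu H.contDiffOn_normal H.contDiffOn_normal i
  rw [pd_congr (f' := fun _ => -1) (fun w hw => H.unitNormal.unit w hw) hu, pd_const,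
    H.metric_symm hu (N u)] at h1
  linarith

/-- Obtained by differentiating g(N, ∂ⱼφ) = 0 along ∂ᵢφ. -/
lemma covAlong_tang_normal (i j : Fin 3) :
    ev2 (g (φ u)) (covAlong s g V φ (fun w => tang V φ w j) u i) (N u)
      = - extrinsic s g V φ N u i j := by
  have h1 := H.pd_metric_along hu H.contDiffOn_normal (H.contDiffOn_tang j) i
  rw [pd_congr (f' := fun _ => 0) (fun w hw => H.unitNormal.normal w hw j) hu, pd_const,
    H.metric_symm hu (N u)] at h1
  have h2 : extrinsic s g V φ N u i j
      = ev2 (g (φ u)) (covAlong s g V φ N u i) (tang V φ u j) := rfl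
  rw [h2]
  linarith

lemma extrinsic_comm (i j : Fin 3) :
    extrinsic s g V φ N u i j = extrinsic s g V φ N u j i := by
  have h1 := H.covAlong_tang_normal hu i j
  rw [H.covAlong_tang_comm hu, H.covAlong_tang_normal hu] at h1
  linarith

/-- The Koszul argument: the tangential part of the derivative is symmetric and compatible with h,
which forces the Christoffel symbols of h. -/
lemma covAlong_tang_tang (i j b : Fin 3) :
    ev2 (g (φ u)) (covAlong s g V φ (fun w => tang V φ w j) u i) (tang V φ u b)
      = ∑ k, indMetric g V φ u b k * christoffel V (indMetric g V φ) u k i j := by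
  rw [sum_metric_christoffel H.isMetricOn_indMetric hu]
  have h1 : ∀ i j k, pd V i (fun w => indMetric g V φ w j k) u
      = ev2 (g (φ u)) (covAlong s g V φ (fun w => tang V φ w j) u i) (tang V φ u k)
        + ev2 (g (φ u)) (covAlong s g V φ (fun w => tang V φ w k) u i) (tang V φ u j) :=
    fun i j k => by
      rw [H.metric_symm hu _ (tang V φ u j)]
      exact H.pd_metric_along hu (H.contDiffOn_tang j) (H.contDiffOn_tang k) i
  rw [h1, h1, h1, H.covAlong_tang_comm hu j i, H.covAlong_tang_comm hu b i,
    H.covAlong_tang_comm hu b j]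
  ring

/-- The Gauss formula. -/
lemma gauss (i j : Fin 3) : covAlong s g V φ (fun w => tang V φ w j) u i = fun a =>
    (∑ k, christoffel V (indMetric g V φ) u k i j * tang V φ u k a)
      + extrinsic s g V φ N u i j * N u a := by
  funext a
  rw [H.expand hu (covAlong s g V φ (fun w => tang V φ w j) u i) a, H.covAlong_tang_normal hu,
    neg_neg]
  congr 1
  refine Finset.sum_congr rfl fun k _ => ?_
  congr 1
  simp only [H.covAlong_tang_tang hu]
  have h1 := Matrix.nonsing_inv_mul (indMetric g V φ u) (H.det_ne_zero u hu).isUnit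
  have h2 : (((indMetric g V φ u)⁻¹ * indMetric g V φ u).mulVec
      fun m => christoffel V (indMetric g V φ) u m i j) k
      = christoffel V (indMetric g V φ) u k i j := by rw [h1, Matrix.one_mulVec]
  rw [← Matrix.mulVec_mulVec] at h2
  exact h2

/-- The Weingarten formula. -/
lemma weingarten (i : Fin 3) : covAlong s g V φ N u i = fun a =>
    ∑ k, (∑ l, (indMetric g V φ u)⁻¹ k l * extrinsic s g V φ N u i l) * tang V φ u k a := by
  funext a
  rw [H.expand hu (covAlong s g V φ N u i) a, H.covAlong_normal_normal hu]
  simp only [neg_zero, zero_mul, add_zero]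
  rfl

end IsSpacelike

/-! ### Multilinearity in the arguments -/

section Linear

variable (c : Fin 3 → ℝ) (d : ℝ) (E : Fin 3 → Fin 4 → ℝ) (Y X Z W : Fin 4 → ℝ)

/-- The inserted vector has the shape given by `gauss`, a tangential combination plus a multiple of
the normal; the Weingarten formula is the case d = 0. -/
lemma ev3_lin1 (t : Fin 4 → Fin 4 → Fin 4 → ℝ) :
    ev3 t (fun a => (∑ k, c k * E k a) + d * Y a) X Z
      = ∑ k, c k * ev3 t (E k) X Z + d * ev3 t Y X Z := by
  simp only [ev3, ev2, ev1_vec_add, ev1_vec_sum, ev1_vec_mul]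

lemma ev3_lin2 (t : Fin 4 → Fin 4 → Fin 4 → ℝ) :
    ev3 t X (fun a => (∑ k, c k * E k a) + d * Y a) Z
      = ∑ k, c k * ev3 t X (E k) Z + d * ev3 t X Y Z := by
  simp only [ev3, ev2, ev1_vec_add, ev1_vec_sum, ev1_vec_mul, ev1_add, ev1_sum, ev1_mul]

lemma ev3_lin3 (t : Fin 4 → Fin 4 → Fin 4 → ℝ) :
    ev3 t X Z (fun a => (∑ k, c k * E k a) + d * Y a)
      = ∑ k, c k * ev3 t X Z (E k) + d * ev3 t X Z Y := by
  simp only [ev3, ev2, ev1_vec_add, ev1_vec_sum, ev1_vec_mul, ev1_add, ev1_sum, ev1_mul]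

lemma ev4_lin1 (t : Fin 4 → Fin 4 → Fin 4 → Fin 4 → ℝ) :
    ev4 t (fun a => (∑ k, c k * E k a) + d * Y a) X Z W
      = ∑ k, c k * ev4 t (E k) X Z W + d * ev4 t Y X Z W := by
  simp only [ev4, ev1_vec_add, ev1_vec_sum, ev1_vec_mul]

lemma ev4_lin2 (t : Fin 4 → Fin 4 → Fin 4 → Fin 4 → ℝ) :
    ev4 t X (fun a => (∑ k, c k * E k a) + d * Y a) Z W
      = ∑ k, c k * ev4 t X (E k) Z W + d * ev4 t X Y Z W := by
  simp only [ev4, ev3_lin1, ev1_add, ev1_sum, ev1_mul]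

lemma ev4_lin3 (t : Fin 4 → Fin 4 → Fin 4 → Fin 4 → ℝ) :
    ev4 t X Z (fun a => (∑ k, c k * E k a) + d * Y a) W
      = ∑ k, c k * ev4 t X Z (E k) W + d * ev4 t X Z Y W := by
  simp only [ev4, ev3_lin2, ev1_add, ev1_sum, ev1_mul]

lemma ev4_lin4 (t : Fin 4 → Fin 4 → Fin 4 → Fin 4 → ℝ) :
    ev4 t X Z W (fun a => (∑ k, c k * E k a) + d * Y a)
      = ∑ k, c k * ev4 t X Z W (E k) + d * ev4 t X Z W Y := by
  simp only [ev4, ev3_lin3, ev1_add, ev1_sum, ev1_mul]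

end Linear

/-! ### Contractions -/

section Contractions

variable {n : ℕ} {G : Matrix (Fin n) (Fin n) ℝ} {t r : Fin n → Fin n → ℝ}

lemma contr_eq_tr : contr G t r = tr G fun a c => tr G fun b d => t c d * r a b := by
  simp only [contr, tr, Finset.mul_sum]
  refine Finset.sum_congr rfl fun a _ => ?_
  rw [Finset.sum_comm]
  exact Finset.sum_congr rfl fun c _ => Finset.sum_congr rfl fun b _ =>
    Finset.sum_congr rfl fun d _ => by ring

lemma contr_swap (ht : ∀ a b, t a b = t b a) : contr G t (fun a b => r b a) = contr G t r := by
  simp only [contr]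
  rw [Finset.sum_comm]
  refine Finset.sum_congr rfl fun a _ => Finset.sum_congr rfl fun b _ => ?_
  rw [Finset.sum_comm]
  exact Finset.sum_congr rfl fun c _ => Finset.sum_congr rfl fun d _ => by rw [ht d c]; ring

lemma contr_neg : contr G t (fun a b => - r a b) = - contr G t r := by
  simp only [contr, mul_neg, Finset.sum_neg_distrib]

/-- Disposes of the terms in which the symmetric K meets an antisymmetric pair of C or A. -/
lemma contr_antisymm (ht : ∀ a b, t a b = t b a) (hr : ∀ a b, r b a = - r a b) :
    contr G t r = 0 := by
  have h := contr_swap (G := G) (r := r) ht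
  have h1 : (fun a b => r b a) = fun a b => - r a b := by funext a b; exact hr a b
  rw [h1, contr_neg] at h
  linarith

lemma contr_comm (hG : ∀ a b, G⁻¹ a b = G⁻¹ b a) : contr G t r = contr G r t := by
  have h1 : contr G t r = ∑ a, ∑ c, ∑ b, ∑ d, G⁻¹ a c * G⁻¹ b d * t c d * r a b :=
    Finset.sum_congr rfl fun a _ => Finset.sum_comm
  rw [h1, Finset.sum_comm]
  refine Finset.sum_congr rfl fun c _ => ?_
  calc _ = ∑ a, ∑ d, ∑ b, G⁻¹ a c * G⁻¹ b d * t c d * r a b :=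
        Finset.sum_congr rfl fun a _ => Finset.sum_comm
    _ = _ := by
        rw [Finset.sum_comm]
        exact Finset.sum_congr rfl fun d _ => Finset.sum_congr rfl fun a _ =>
          Finset.sum_congr rfl fun b _ => by rw [hG a c, hG b d]; ring

/-- The trace of the product of a tensor with a raised index and another tensor. -/
lemma tr_raise_mul (hG : ∀ a b, G⁻¹ a b = G⁻¹ b a) :
    tr G (fun i k => ∑ l, (∑ m, G⁻¹ l m * t i m) * r k l) = contr G t r := by
  simp only [tr, contr]
  rw [Finset.sum_comm]
  refine Finset.sum_congr rfl fun k _ => ?_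
  simp only [Finset.mul_sum, Finset.sum_mul]
  rw [Finset.sum_comm]
  exact Finset.sum_congr rfl fun l _ => Finset.sum_congr rfl fun i _ =>
    Finset.sum_congr rfl fun m _ => by rw [hG i k]; ring

end Contractions

/-! ### The Weyl, Cotton and Bach tensors in the adapted frame -/

/-- The part `A_{⊥⊥j}` of the Cotton tensor. -/
def cottonNNT (s : Set (Coord 4)) (g : Coord 4 → Matrix (Fin 4) (Fin 4) ℝ) (V : Set (Coord 3))
    (φ : Coord 3 → Coord 4) (N : Coord 3 → Fin 4 → ℝ) (u : Coord 3) (j : Fin 3) : ℝ :=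
  ev3 (cotton s g (φ u)) (N u) (N u) (tang V φ u j)

section Symmetries

variable {s : Set (Coord 4)} {g : Coord 4 → Matrix (Fin 4) (Fin 4) ℝ} {x : Coord 4}

lemma ev4_weyl_swap12 (X Y Z W : Fin 4 → ℝ) :
    ev4 (weyl s g x) Y X Z W = - ev4 (weyl s g x) X Y Z W :=
  ev4_swap12 weyl_swap12 X Y Z W

lemma ev4_weyl_diag (X Y Z : Fin 4 → ℝ) : ev4 (weyl s g x) X X Y Z = 0 := by
  linarith [ev4_weyl_swap12 (s := s) (g := g) (x := x) X X Y Z]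

lemma ev3_cotton_diag (X Y : Fin 4 → ℝ) : ev3 (cotton s g x) X Y Y = 0 := by
  linarith [ev3_swap (cotton_swap (s := s) (g := g) (x := x)) X Y Y]

lemma ev2_ev2_weyl (X Y P Q : Fin 4 → ℝ) :
    ev2 (fun d c => ev2 (fun a b => weyl s g x d a c b) X Y) P Q
      = ev4 (weyl s g x) P X Q Y := by
  simp only [ev4, ev3, ev2]
  congr 1; funext d
  rw [ev1_comm]

lemma ev2_ev2_last (t : Fin 4 → Fin 4 → Fin 4 → Fin 4 → ℝ) (X Y P Q : Fin 4 → ℝ) :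
    ev2 (fun k c => ev2 (fun a b => t k a b c) X Y) P Q = ev1 (fun k => ev3 (t k) X Y Q) P := by
  simp only [ev3, ev2]
  congr 1; funext k
  rw [ev1_comm]
  congr 1; funext a
  rw [ev1_comm]

end Symmetries

namespace IsSpacelike

variable {s : Set (Coord 4)} {g : Coord 4 → Matrix (Fin 4) (Fin 4) ℝ}
  {V : Set (Coord 3)} {φ : Coord 3 → Coord 4} {N : Coord 3 → Fin 4 → ℝ} {u : Coord 3}
  (H : IsSpacelike s g V φ N) (hu : u ∈ V)
include H

lemma contDiffOn_electric (i j : Fin 3) :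
    ContDiffOn ℝ ∞ (fun w => electric s g V φ N w i j) V :=
  contDiffOn_ev4 (t := fun w => weyl s g (φ w))
    (fun a b c d => H.contDiffOn_comp (smooth4_weyl H.regular H.metric a b c d))
    H.contDiffOn_normal (H.contDiffOn_tang i) H.contDiffOn_normal (H.contDiffOn_tang j)

lemma contDiffOn_cottonNNT (j : Fin 3) : ContDiffOn ℝ ∞ (fun w => cottonNNT s g V φ N w j) V :=
  contDiffOn_ev3 (t := fun w => cotton s g (φ w))
    (fun a b c => H.contDiffOn_comp (contDiffOn_cotton H.regular H.metric a b c))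
    H.contDiffOn_normal H.contDiffOn_normal (H.contDiffOn_tang j)

lemma contDiffOn_div2_electric (j : Fin 3) : ContDiffOn ℝ ∞
    (fun w => div2 V (indMetric g V φ) (electric s g V φ N) w j) V :=
  contDiffOn_tr H.isMetricOn_indMetric fun k b =>
    contDiffOn_cov2 H.regular_param H.isMetricOn_indMetric H.contDiffOn_electric k j b

/-! ### Frame components of the Weyl tensor and of its divergence. -/

include hu

lemma weyl_swap34 (X Y Z W : Fin 4 → ℝ) :
    ev4 (weyl s g (φ u)) X Y W Z = - ev4 (weyl s g (φ u)) X Y Z W :=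
  ev4_swap34 (BachConstraint.weyl_swap34 H.regular H.metric (H.mapsTo hu)) X Y Z W

lemma weyl_pair (X Y Z W : Fin 4 → ℝ) :
    ev4 (weyl s g (φ u)) Z W X Y = ev4 (weyl s g (φ u)) X Y Z W :=
  ev4_pair (BachConstraint.weyl_pair H.regular H.metric (H.mapsTo hu)) X Y Z W

lemma inv_comm (i j : Fin 3) : (indMetric g V φ u)⁻¹ i j = (indMetric g V φ u)⁻¹ j i :=
  H.isMetricOn_indMetric.inv_apply_comm hu i j

lemma weyl_TNNT (j k : Fin 3) :
    ev4 (weyl s g (φ u)) (tang V φ u k) (N u) (N u) (tang V φ u j)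
      = - electric s g V φ N u j k := by
  rw [← H.weyl_pair hu, H.weyl_swap34 hu, electric]

/-- Obtained by differentiating C(∂ₖφ, N, N, ∂ⱼφ) = -E along ∂ᵢφ. The tangential Gauss terms turn
the partial derivative of E into the intrinsic one, the normal Gauss terms repeat N in an
antisymmetric pair and vanish, and the two derivatives of N give the K terms. -/
lemma cov4_weyl_frame (i j k : Fin 3) :
    ev1 (fun m => ev4 (cov4 s g (weyl s g) (φ u) m) (tang V φ u k) (N u) (N u) (tang V φ u j))
        (tang V φ u i)
      = - cov2 V (indMetric g V φ) (electric s g V φ N) u i j k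
        - ∑ l, (∑ m, (indMetric g V φ u)⁻¹ l m * extrinsic s g V φ N u i m)
            * ev4 (weyl s g (φ u)) (tang V φ u k) (tang V φ u l) (N u) (tang V φ u j)
        + ∑ l, (∑ m, (indMetric g V φ u)⁻¹ l m * extrinsic s g V φ N u i m)
            * weylTTTN s g V φ N u j l k := by
  have h1 := pd_ev4_along (g := g) H.regular_param H.contDiffOn H.mapsTo hu i
    (H.contDiffOn_tang k) H.contDiffOn_normal H.contDiffOn_normal (H.contDiffOn_tang j)
    (smooth4_weyl H.regular H.metric)
  have hW : covAlong s g V φ N u i = fun a =>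
      (∑ k, (∑ l, (indMetric g V φ u)⁻¹ k l * extrinsic s g V φ N u i l) * tang V φ u k a)
        + 0 * N u a := by
    rw [H.weingarten hu]; simp
  rw [pd_congr (f' := fun w => - electric s g V φ N w j k) (fun w hw => H.weyl_TNNT hw j k) hu,
    pd_neg H.regular_param hu, H.gauss hu i k, H.gauss hu i j, hW, ev4_lin1, ev4_lin2, ev4_lin3,
    ev4_lin4] at h1
  simp only [H.weyl_TNNT hu] at h1
  have z2 : ev4 (weyl s g (φ u)) (tang V φ u k) (N u) (N u) (N u) = 0 := by
    linarith [H.weyl_swap34 hu (tang V φ u k) (N u) (N u) (N u)]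
  have h2 : ∀ l, ev4 (weyl s g (φ u)) (tang V φ u k) (N u) (tang V φ u l) (tang V φ u j)
      = - weylTTTN s g V φ N u j l k := fun l => by
    rw [← H.weyl_pair hu, ev4_weyl_swap12, weylTTTN]
  simp only [ev4_weyl_diag, z2, h2, mul_zero, zero_mul, add_zero, mul_neg, Finset.sum_neg_distrib] at h1
  rw [cov2]
  linarith

/-- The component `A_{⊥⊥j}` of the Cotton tensor in terms of the Weyl tensor. -/
lemma cottonNNT_eq (j : Fin 3) : cottonNNT s g V φ N u j =
    - div2 V (indMetric g V φ) (electric s g V φ N) u j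
      + contr (indMetric g V φ u) (extrinsic s g V φ N u) (weylTTTN s g V φ N u j) := by
  have hx := H.mapsTo hu
  have h1 : cottonNNT s g V φ N u j = tr (g (φ u)) fun k a =>
      ev3 (cov4 s g (weyl s g) (φ u) k a) (N u) (N u) (tang V φ u j) := by
    have : cotton s g (φ u) = fun b c d =>
        tr (g (φ u)) fun k a => cov4 s g (weyl s g) (φ u) k a b c d := by
      funext b c d; exact (div_weyl H.regular H.metric hx b c d).symm
    rw [cottonNNT, this]
    simp only [ev3, ev2, tr_ev1]
  rw [h1, H.tr_eq hu]
  have h2 : ∀ X Y, ev2 (fun k a => ev3 (cov4 s g (weyl s g) (φ u) k a) (N u) (N u)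
      (tang V φ u j)) X Y
      = ev1 (fun m => ev4 (cov4 s g (weyl s g) (φ u) m) Y (N u) (N u) (tang V φ u j)) X :=
    fun X Y => rfl
  -- The normal part of the trace has N in the first two slots of ∇C, so no normal derivative of C
  -- survives.
  have h3 : ∀ m, ev4 (cov4 s g (weyl s g) (φ u) m) (N u) (N u) (N u) (tang V φ u j) = 0 :=
    fun m => by
      linarith [ev4_swap12 (cov4_weyl_swap12 (g := g) H.regular hx m) (N u) (N u) (N u) (tang V φ u j)]
  simp only [h2, h3, H.cov4_weyl_frame hu]
  -- The first K term contracts K with the first, antisymmetric pair of C and drops out.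
  rw [tr_add, tr_sub, tr_neg, tr_raise_mul (H.inv_comm hu), tr_raise_mul (H.inv_comm hu)
      (r := fun k l => weylTTTN s g V φ N u j l k),
    contr_swap (r := weylTTTN s g V φ N u j) (H.extrinsic_comm hu),
    contr_antisymm (H.extrinsic_comm hu) (fun k l => ev4_weyl_swap12 _ _ _ _)]
  simp [ev1, div2]

/-- Antisymmetry in the last two slots survives covariant differentiation. With Y = Z = N this
removes the normal derivative from the divergence of the Cotton tensor. -/
lemma cov3_cotton_zero (X Y Z : Fin 4 → ℝ) :
    ev1 (fun k => ev3 (cov3 s g (cotton s g) (φ u) k) X Y Y) Z = 0 := by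
  have h : ∀ k, ev3 (cov3 s g (cotton s g) (φ u) k) X Y Y = 0 := fun k => by
    linarith [ev3_swap (cov3_cotton_swap (g := g) H.regular (H.mapsTo hu) k) X Y Y]
  simp [h, ev1]

/-- The divergence of the Cotton tensor in terms of the adapted frame. -/
lemma div_cotton_eq (X : Fin 4 → ℝ) :
    ev2 (fun a b => tr (g (φ u)) fun k c => cov3 s g (cotton s g) (φ u) k a b c) X (N u)
      = tr (indMetric g V φ u) fun i j =>
          ev1 (fun k => ev3 (cov3 s g (cotton s g) (φ u) k) X (N u) (tang V φ u j))
            (tang V φ u i) := by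
  have h1 := ev2_ev2_last (cov3 s g (cotton s g) (φ u)) X (N u)
  have h2 : ev2 (fun a b => tr (g (φ u)) fun k c => cov3 s g (cotton s g) (φ u) k a b c) X (N u)
      = tr (g (φ u)) fun k c => ev2 (fun a b => cov3 s g (cotton s g) (φ u) k a b c) X (N u) := by
    simp only [ev2, tr_ev1]
  rw [h2, H.tr_eq hu]
  simp only [h1, H.cov3_cotton_zero hu, sub_zero]

lemma weingarten_add (i : Fin 3) : covAlong s g V φ N u i = fun a =>
    (∑ k, (∑ l, (indMetric g V φ u)⁻¹ k l * extrinsic s g V φ N u i l) * tang V φ u k a)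
      + 0 * N u a := by
  rw [H.weingarten hu]; simp

lemma tr_extrinsic_cotton (X : Fin 4 → ℝ) :
    tr (indMetric g V φ u) (fun i j => ∑ l, (∑ m, (indMetric g V φ u)⁻¹ l m
      * extrinsic s g V φ N u i m) * ev3 (cotton s g (φ u)) X (tang V φ u l) (tang V φ u j)) = 0 := by
  rw [tr_raise_mul (H.inv_comm hu)
    (r := fun j l => ev3 (cotton s g (φ u)) X (tang V φ u l) (tang V φ u j))]
  exact contr_antisymm (H.extrinsic_comm hu) fun a b => ev3_swap cotton_swap _ _ _

/-- The derivative of the first N gives K contracted with A^⊤_{i⊥j}. That of the second N gives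
A_{⊥ij}, antisymmetric and killed by K. The normal part of the derivative of ∂ⱼφ meets A_{⊥⊥⊥} = 0.
-/
lemma div_cotton_normal :
    ev2 (fun a b => tr (g (φ u)) fun k c => cov3 s g (cotton s g) (φ u) k a b c) (N u) (N u)
      = div1 V (indMetric g V φ) (cottonNNT s g V φ N) u
        - contr (indMetric g V φ u) (extrinsic s g V φ N u) (cottonTNT s g V φ N u) := by
  rw [H.div_cotton_eq hu]
  have h1 : ∀ i j, ev1 (fun k => ev3 (cov3 s g (cotton s g) (φ u) k) (N u) (N u) (tang V φ u j))
      (tang V φ u i) = cov1 V (indMetric g V φ) (cottonNNT s g V φ N) u i j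
        - ∑ l, (∑ m, (indMetric g V φ u)⁻¹ l m * extrinsic s g V φ N u i m)
            * cottonTNT s g V φ N u l j
        - ∑ l, (∑ m, (indMetric g V φ u)⁻¹ l m * extrinsic s g V φ N u i m)
            * ev3 (cotton s g (φ u)) (N u) (tang V φ u l) (tang V φ u j) := fun i j => by
    have h2 := pd_ev3_along (g := g) H.regular_param H.contDiffOn H.mapsTo hu i
      H.contDiffOn_normal H.contDiffOn_normal (H.contDiffOn_tang j)
      (contDiffOn_cotton H.regular H.metric)
    rw [H.gauss hu i j, H.weingarten_add hu, ev3_lin1, ev3_lin2, ev3_lin3,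
      ev3_cotton_diag] at h2
    simp only [zero_mul, mul_zero, add_zero] at h2
    have h3 : pd V i (fun w => cottonNNT s g V φ N w j) u
      = pd V i (fun w => ev3 (cotton s g (φ w)) (N w) (N w) (tang V φ w j)) u := rfl
    rw [cov1, h3, h2]
    simp only [cottonNNT, cottonTNT]
    ring
  simp only [h1]
  rw [tr_sub, tr_sub, H.tr_extrinsic_cotton hu, tr_raise_mul (H.inv_comm hu)
    (r := fun j l => cottonTNT s g V φ N u l j), contr_swap (H.extrinsic_comm hu), div1, sub_zero]

/-- Here the normal part of the derivative of ∂ₐφ produces A_{⊥⊥j} multiplied by K; the other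
extrinsic terms vanish by antisymmetry of A. -/
lemma div_cotton_tang (a : Fin 3) :
    ev2 (fun a b => tr (g (φ u)) fun k c => cov3 s g (cotton s g) (φ u) k a b c)
        (tang V φ u a) (N u)
      = div2 V (indMetric g V φ) (cottonTNT s g V φ N) u a
        - tr (indMetric g V φ u) fun i j => extrinsic s g V φ N u i a * cottonNNT s g V φ N u j := by
  rw [H.div_cotton_eq hu]
  have h1 : ∀ i j, ev1 (fun k => ev3 (cov3 s g (cotton s g) (φ u) k) (tang V φ u a) (N u)
      (tang V φ u j)) (tang V φ u i) = cov2 V (indMetric g V φ) (cottonTNT s g V φ N) u i a j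
        - extrinsic s g V φ N u i a * cottonNNT s g V φ N u j
        - ∑ l, (∑ m, (indMetric g V φ u)⁻¹ l m * extrinsic s g V φ N u i m)
            * ev3 (cotton s g (φ u)) (tang V φ u a) (tang V φ u l) (tang V φ u j) := fun i j => by
    have h2 := pd_ev3_along (g := g) H.regular_param H.contDiffOn H.mapsTo hu i
      (H.contDiffOn_tang a) H.contDiffOn_normal (H.contDiffOn_tang j)
      (contDiffOn_cotton H.regular H.metric)
    rw [H.gauss hu i j, H.gauss hu i a, H.weingarten_add hu, ev3_lin1, ev3_lin2, ev3_lin3,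
      ev3_cotton_diag] at h2
    simp only [zero_mul, mul_zero, add_zero] at h2
    have h3 : pd V i (fun w => cottonTNT s g V φ N w a j) u
      = pd V i (fun w => ev3 (cotton s g (φ w)) (tang V φ w a) (N w) (tang V φ w j)) u := rfl
    rw [cov2, h3, h2]
    simp only [cottonNNT, cottonTNT]
    ring
  simp only [h1]
  rw [tr_sub, tr_sub, H.tr_extrinsic_cotton hu, div2, sub_zero]

/-! ### The Bach tensor with a normal argument. -/

/-- The full contraction in terms of the adapted frame. -/
lemma contr_eq (t r : Fin 4 → Fin 4 → ℝ) : contr (g (φ u)) t r =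
    contr (indMetric g V φ u) (fun i j => ev2 t (tang V φ u i) (tang V φ u j))
        (fun i j => ev2 r (tang V φ u i) (tang V φ u j))
      - tr (indMetric g V φ u) (fun i j => ev2 t (tang V φ u j) (N u) * ev2 r (tang V φ u i) (N u))
      - tr (indMetric g V φ u) (fun i j => ev2 t (N u) (tang V φ u j) * ev2 r (N u) (tang V φ u i))
      + ev2 t (N u) (N u) * ev2 r (N u) (N u) := by
  have h1 : ∀ (p q X Y : Fin 4 → ℝ),
      ev2 (fun b d => p d * q b) X Y = ev1 p Y * ev1 q X := fun p q X Y => by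
    simp only [ev2, ev1_mul_right, ev1_mul]
  have h3 : ∀ (f : Fin 3 → Fin 3 → Fin 4 → Fin 4 → ℝ) (X Y : Fin 4 → ℝ),
      ev2 (fun a c => tr (indMetric g V φ u) fun i j => f i j a c) X Y
        = tr (indMetric g V φ u) fun i j => ev2 (f i j) X Y := fun f X Y => by
    simp only [tr, ev2, ev1_sum, ev1_mul]
  have h4 : ∀ (f k : Fin 4 → Fin 4 → ℝ) (X Y : Fin 4 → ℝ),
      ev2 (fun a c => f a c - k a c) X Y = ev2 f X Y - ev2 k X Y := fun f k X Y => by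
    simp only [ev2, ev1_sub]
  rw [contr_eq_tr]
  simp only [H.tr_eq hu, h1, h3, h4]
  rw [tr_sub, contr_eq_tr]
  simp only [ev2]
  ring

lemma weyl_34_diag (X Y Z : Fin 4 → ℝ) : ev4 (weyl s g (φ u)) X Y Z Z = 0 := by
  linarith [H.weyl_swap34 hu X Y Z Z]

/-- The normal fills the fourth slot of C, so frame terms with N in the third slot vanish. The
purely tangential term and one mixed term remain. -/
lemma bach_eq (X : Fin 4 → ℝ) : ev2 (bach s g (φ u)) X (N u) =
    - ev2 (fun a b => tr (g (φ u)) fun k c => cov3 s g (cotton s g) (φ u) k a b c) X (N u)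
      + contr (indMetric g V φ u) (schoutenTT s g V φ u)
          (fun i j => ev4 (weyl s g (φ u)) (tang V φ u i) X (tang V φ u j) (N u))
      - tr (indMetric g V φ u) fun i j => schoutenNT s g V φ N u j
          * ev4 (weyl s g (φ u)) (N u) X (tang V φ u i) (N u) := by
  have h1 : ev2 (bach s g (φ u)) X (N u) =
    - ev2 (fun a b => tr (g (φ u)) fun k c => cov3 s g (cotton s g) (φ u) k a b c) X (N u)
      + contr (g (φ u)) (schouten s g (φ u))
          (fun d c => ev2 (fun a b => weyl s g (φ u) d a c b) X (N u)) := by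
    have h2 : bach s g (φ u) = fun a b =>
        - tr (g (φ u)) (fun k c => cov3 s g (cotton s g) (φ u) k a b c)
          + contr (g (φ u)) (schouten s g (φ u)) (fun d c => weyl s g (φ u) d a c b) := rfl
    rw [h2]
    simp only [ev2, ev1_add, ev1_neg, contr, ev1_sum, ev1_mul]
  rw [h1, H.contr_eq hu]
  simp only [ev2_ev2_weyl, H.weyl_34_diag hu, mul_zero, add_zero]
  have h0 : tr (indMetric g V φ u) (fun _ _ => 0) = 0 := by simp [tr]
  rw [h0, sub_zero, ← add_sub_assoc]
  rfl

/-- `cottonNNT_eq` holds on all of V and may be differentiated. Solving it for the K·C term exhibits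
that term as a sum of two smooth fields, so its smoothness needs no separate proof. -/
lemma div1_cottonNNT : div1 V (indMetric g V φ) (cottonNNT s g V φ N) u =
    - div1 V (indMetric g V φ) (div2 V (indMetric g V φ) (electric s g V φ N)) u
      + div1 V (indMetric g V φ) (fun x c => contr (indMetric g V φ x) (extrinsic s g V φ N x)
          (weylTTTN s g V φ N x c)) u := by
  have h1 : ∀ k c, cov1 V (indMetric g V φ) (fun x c => contr (indMetric g V φ x)
      (extrinsic s g V φ N x) (weylTTTN s g V φ N x c)) u k c
      = cov1 V (indMetric g V φ) (cottonNNT s g V φ N) u k c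
        + cov1 V (indMetric g V φ) (div2 V (indMetric g V φ) (electric s g V φ N)) u k c :=
    fun k c => by
      have h2 : ∀ c, EqOn (fun w => contr (indMetric g V φ w)
          (extrinsic s g V φ N w) (weylTTTN s g V φ N w c))
          (fun w => cottonNNT s g V φ N w c
            + div2 V (indMetric g V φ) (electric s g V φ N) w c) V := fun c w hw => by
        simp only [H.cottonNNT_eq hw]; ring
      have h3 := fun c => h2 c hu
      simp only at h3
      rw [cov1, pd_congr (h2 c) hu,
        pd_add H.regular_param (H.contDiffOn_cottonNNT c) (H.contDiffOn_div2_electric c) hu]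
      simp only [h3, cov1, mul_add, Finset.sum_add_distrib]
      ring
  have h4 : cov1 V (indMetric g V φ) (fun x c => contr (indMetric g V φ x)
      (extrinsic s g V φ N x) (weylTTTN s g V φ N x c)) u = fun k c =>
      cov1 V (indMetric g V φ) (cottonNNT s g V φ N) u k c
        + cov1 V (indMetric g V φ) (div2 V (indMetric g V φ) (electric s g V φ N)) u k c := by
    funext k c; exact h1 k c
  simp only [div1, h4, tr_add]
  ring

/-- The normal-normal component of the Bach tensor. -/
theorem bach_normal_normal : ev2 (bach s g (φ u)) (N u) (N u) =
    div1 V (indMetric g V φ) (div2 V (indMetric g V φ) (electric s g V φ N)) u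
      - div1 V (indMetric g V φ) (fun x c => contr (indMetric g V φ x) (extrinsic s g V φ N x)
          (weylTTTN s g V φ N x c)) u
      + contr (indMetric g V φ u) (electric s g V φ N u) (schoutenTT s g V φ u)
      + contr (indMetric g V φ u) (extrinsic s g V φ N u) (cottonTNT s g V φ N u) := by
  have h0 : tr (indMetric g V φ u) (fun _ _ => 0) = 0 := by simp [tr]
  have h1 : (fun i j => ev4 (weyl s g (φ u)) (tang V φ u i) (N u) (tang V φ u j) (N u))
      = electric s g V φ N u := by
    funext i j
    rw [ev4_weyl_swap12, H.weyl_swap34 hu, neg_neg, electric]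
  rw [H.bach_eq hu, H.div_cotton_normal hu, H.div1_cottonNNT hu, h1,
    contr_comm (H.inv_comm hu) (t := schoutenTT s g V φ u)]
  -- The mixed Schouten term contains C(N, N, ·, ·) = 0.
  simp only [ev4_weyl_diag, mul_zero, h0]
  ring

/-- The tangential-normal component of the Bach tensor. -/
theorem bach_tang_normal (a : Fin 3) : ev2 (bach s g (φ u)) (tang V φ u a) (N u) =
    - div2 V (indMetric g V φ) (cottonTNT s g V φ N) u a
      - ∑ c, ∑ d, (indMetric g V φ u)⁻¹ c d
          * div2 V (indMetric g V φ) (electric s g V φ N) u c * extrinsic s g V φ N u a d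
      + contr (indMetric g V φ u) (extrinsic s g V φ N u) (fun b c =>
          ∑ d, ∑ f, (indMetric g V φ u)⁻¹ d f * extrinsic s g V φ N u a f
            * weylNTTT s g V φ N u b c d)
      + contr (indMetric g V φ u) (schoutenTT s g V φ u) (fun c d =>
          ev4 (weyl s g (φ u)) (tang V φ u d) (tang V φ u a) (tang V φ u c) (N u))
      + ∑ b, ∑ d, (indMetric g V φ u)⁻¹ b d * schoutenNT s g V φ N u b
          * electric s g V φ N u a d := by
  have hP : ∀ i j, schoutenTT s g V φ u i j = schoutenTT s g V φ u j i := fun i j => by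
    rw [schoutenTT, ← ev2_swap]
    congr 1
    funext a b
    exact schouten_comm H.regular H.metric (H.mapsTo hu) b a
  have h1 : ∀ i, ev4 (weyl s g (φ u)) (N u) (tang V φ u a) (tang V φ u i) (N u)
      = - electric s g V φ N u a i := fun i => by rw [H.weyl_swap34 hu, electric]
  have h2 : tr (indMetric g V φ u) (fun i j => schoutenNT s g V φ N u j
          * ev4 (weyl s g (φ u)) (N u) (tang V φ u a) (tang V φ u i) (N u))
      = - ∑ b, ∑ d, (indMetric g V φ u)⁻¹ b d * schoutenNT s g V φ N u b
          * electric s g V φ N u a d := by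
    simp only [h1, tr, mul_neg, Finset.sum_neg_distrib]
    rw [Finset.sum_comm]
    exact congrArg Neg.neg (Finset.sum_congr rfl fun i _ => Finset.sum_congr rfl fun j _ => by
      rw [H.inv_comm hu]; ring)
  -- Pair symmetry and both antisymmetries turn C_{⊥bcd} into C_{dcb⊥}, the component that occurs in
  -- A_{⊥⊥d}.
  have h3 : ∀ b c d, weylNTTT s g V φ N u b c d = weylTTTN s g V φ N u d c b := fun b c d => by
    rw [weylNTTT, ← H.weyl_pair hu, ev4_weyl_swap12, H.weyl_swap34 hu, neg_neg, weylTTTN]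
  have h4 : contr (indMetric g V φ u) (extrinsic s g V φ N u) (fun b c =>
          ∑ d, ∑ f, (indMetric g V φ u)⁻¹ d f * extrinsic s g V φ N u a f
            * weylNTTT s g V φ N u b c d)
      = ∑ d, ∑ f, (indMetric g V φ u)⁻¹ d f * extrinsic s g V φ N u a f
          * contr (indMetric g V φ u) (extrinsic s g V φ N u) (weylTTTN s g V φ N u d) := by
    rw [← contr_swap (H.extrinsic_comm hu)]
    simp only [h3, contr_eq_tr, Finset.mul_sum, tr_sum, ← tr_const_mul, mul_left_comm]
  -- Substituting A_{⊥⊥j} produces both the div E term and the term quadratic in K.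
  have h5 : tr (indMetric g V φ u) (fun i j => extrinsic s g V φ N u i a
        * cottonNNT s g V φ N u j)
      = - ∑ c, ∑ d, (indMetric g V φ u)⁻¹ c d
          * div2 V (indMetric g V φ) (electric s g V φ N) u c * extrinsic s g V φ N u a d
        + ∑ d, ∑ f, (indMetric g V φ u)⁻¹ d f * extrinsic s g V φ N u a f
          * contr (indMetric g V φ u) (extrinsic s g V φ N u) (weylTTTN s g V φ N u d) := by
    simp only [H.cottonNNT_eq hu, tr]
    rw [Finset.sum_comm, ← Finset.sum_neg_distrib, ← Finset.sum_add_distrib]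
    refine Finset.sum_congr rfl fun i _ => ?_
    rw [← Finset.sum_neg_distrib, ← Finset.sum_add_distrib]
    exact Finset.sum_congr rfl fun j _ => by
      rw [H.inv_comm hu, H.extrinsic_comm hu j a]; ring
  rw [H.bach_eq hu, H.div_cotton_tang hu, h2, h4, h5, ← contr_swap hP]
  ring

end IsSpacelike

/-! ### Lorentzian linear algebra -/

section Lorentz

variable {G : Matrix (Fin 4) (Fin 4) ℝ}

/-- `G` is congruent to the Minkowski metric. -/
def IsLorentzMatrix (G : Matrix (Fin 4) (Fin 4) ℝ) : Prop :=
  ∃ B : Matrix (Fin 4) (Fin 4) ℝ, IsUnit B.det ∧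
    ∀ i j, G i j = -(B 0 i * B 0 j) + B 1 i * B 1 j + B 2 i * B 2 j + B 3 i * B 3 j

lemma IsLorentzMatrix.det_ne_zero (hG : IsLorentzMatrix G) : G.det ≠ 0 := by
  obtain ⟨B, hB, h⟩ := hG
  have h1 : G = B.transpose * (Matrix.diagonal ![-1, 1, 1, 1] * B) := by
    ext i j
    simp [h, Matrix.mul_apply, Fin.sum_univ_four, Matrix.diagonal_apply]
  rw [h1]
  simp [Matrix.det_mul, Fin.prod_univ_four, hB.ne_zero]

lemma IsLorentzMatrix.comm (hG : IsLorentzMatrix G) (i j : Fin 4) : G i j = G j i := by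
  obtain ⟨B, -, h⟩ := hG
  rw [h, h]; ring

/-- Vectors orthogonal to a timelike vector are spacelike. -/
lemma IsLorentzMatrix.pos_of_orthogonal (hG : IsLorentzMatrix G) {ν X : Fin 4 → ℝ}
    (hν : ev2 G ν ν < 0) (hX : ev2 G X ν = 0) (h0 : X ≠ 0) : 0 < ev2 G X X := by
  obtain ⟨B, hB, h⟩ := hG
  have key : ∀ Y Z : Fin 4 → ℝ, ev2 G Y Z = -(B.mulVec Y 0 * B.mulVec Z 0)
      + B.mulVec Y 1 * B.mulVec Z 1 + B.mulVec Y 2 * B.mulVec Z 2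
      + B.mulVec Y 3 * B.mulVec Z 3 := fun Y Z => by
    simp only [ev2, ev1, h, Matrix.mulVec, dotProduct, Fin.sum_univ_four]
    ring
  rw [key] at hν hX ⊢
  have hne : B.mulVec X ≠ 0 := fun hz => h0 <| by
    have := congrArg B⁻¹.mulVec hz
    rwa [Matrix.mulVec_mulVec, Matrix.nonsing_inv_mul _ hB, Matrix.one_mulVec,
      Matrix.mulVec_zero] at this
  set p := B.mulVec ν
  set q := B.mulVec X
  have hp : 0 < p 0 ^ 2 := by nlinarith [sq_nonneg (p 1), sq_nonneg (p 2), sq_nonneg (p 3)]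
  -- Cauchy-Schwarz for the spatial parts; orthogonality turns its left side into (q₀p₀)².
  have hCS : (q 1 * p 1 + q 2 * p 2 + q 3 * p 3) ^ 2
      ≤ (q 1 ^ 2 + q 2 ^ 2 + q 3 ^ 2) * (p 1 ^ 2 + p 2 ^ 2 + p 3 ^ 2) := by
    nlinarith [sq_nonneg (q 1 * p 2 - q 2 * p 1), sq_nonneg (q 1 * p 3 - q 3 * p 1),
      sq_nonneg (q 2 * p 3 - q 3 * p 2)]
  have hqp : q 1 * p 1 + q 2 * p 2 + q 3 * p 3 = q 0 * p 0 := by linarith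
  rw [hqp] at hCS
  -- If the spatial part of q vanished, orthogonality and p₀ ≠ 0 would give q = 0.
  have hQ : 0 < q 1 ^ 2 + q 2 ^ 2 + q 3 ^ 2 := by
    by_contra hcon
    have h1 : q 1 = 0 := by nlinarith [sq_nonneg (q 1), sq_nonneg (q 2), sq_nonneg (q 3)]
    have h2 : q 2 = 0 := by nlinarith [sq_nonneg (q 1), sq_nonneg (q 2), sq_nonneg (q 3)]
    have h3 : q 3 = 0 := by nlinarith [sq_nonneg (q 1), sq_nonneg (q 2), sq_nonneg (q 3)]
    have h4 : q 0 = 0 := by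
      rw [h1, h2, h3] at hqp
      have hp0 : p 0 ≠ 0 := fun h => by simp [h] at hp
      have : q 0 * p 0 = 0 := by linarith
      exact (mul_eq_zero.1 this).resolve_right hp0
    exact hne (funext fun i => by fin_cases i <;> simp [h1, h2, h3, h4])
  have hlt : p 1 ^ 2 + p 2 ^ 2 + p 3 ^ 2 < p 0 ^ 2 := by nlinarith
  have : q 0 ^ 2 * p 0 ^ 2 < (q 1 ^ 2 + q 2 ^ 2 + q 3 ^ 2) * p 0 ^ 2 := by nlinarith
  have := lt_of_mul_lt_mul_right this hp.le
  nlinarith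

/-- The kernel of a timelike covector is spacelike. -/
lemma IsLorentzMatrix.pos_of_covector (hG : IsLorentzMatrix G) {t X : Fin 4 → ℝ}
    (ht : tr G (fun a b => t a * t b) < 0) (hX : ev1 t X = 0) (h0 : X ≠ 0) : 0 < ev2 G X X := by
  -- Raising the index of t reduces the claim to vectors orthogonal to a timelike vector.
  have h1 : ∀ Y, ev2 G Y (G⁻¹.mulVec t) = ev1 t Y := fun Y => by
    have h2 : G.mulVec (G⁻¹.mulVec t) = t := by
      rw [Matrix.mulVec_mulVec, Matrix.mul_nonsing_inv _ hG.det_ne_zero.isUnit, Matrix.one_mulVec]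
    have h3 : ev2 G Y (G⁻¹.mulVec t) = ev1 (G.mulVec (G⁻¹.mulVec t)) Y := rfl
    rw [h3, h2]
  refine hG.pos_of_orthogonal (ν := G⁻¹.mulVec t) ?_ (by rw [h1, hX]) h0
  rw [h1]
  convert ht using 1
  simp only [ev1, tr, Matrix.mulVec, dotProduct, Finset.mul_sum]
  exact Finset.sum_congr rfl fun a _ => Finset.sum_congr rfl fun b _ => by ring

/-- A bilinear form in terms of the coefficients with respect to an orthonormal frame. -/
lemma bilin_minkowski_frame {E : Type*} [AddCommGroup E] [Module ℝ E]
    (β : LinearMap.BilinForm ℝ E) (b : Fin 4 → E)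
    (hb : ∀ i j, β (b i) (b j) = if i = j then (if i = 0 then -1 else 1) else 0)
    (x y : Fin 4 → ℝ) : β (∑ l, x l • b l) (∑ l, y l • b l)
      = -(x 0 * y 0) + x 1 * y 1 + x 2 * y 2 + x 3 * y 3 := by
  simp [Fin.sum_univ_four, hb]

end Lorentz

/-! ### Charts of a manifold with boundary -/

section Manifold

/-- The coordinate domain is an open set intersected with the half-space, which lies in the closure
of its interior. -/
lemma regularDomain_dom {M : Type*} [TopologicalSpace M]
    {e : OpenPartialHomeomorph M (EuclideanHalfSpace 4)} : RegularDomain (dom e) := by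
  have h : dom e = (𝓡∂ 4).symm ⁻¹' e.target ∩ range (𝓡∂ 4) := e.extend_target
  constructor
  · rw [h]
    exact (𝓡∂ 4).uniqueDiffOn_preimage e.open_target
  · have ho : IsOpen ((𝓡∂ 4).symm ⁻¹' e.target) :=
      e.open_target.preimage (𝓡∂ 4).continuous_symm
    rw [h, interior_inter, ho.interior_eq]
    refine Subset.trans ?_ ho.inter_closure
    exact inter_subset_inter_right _ (𝓡∂ 4).range_subset_closure_interior

variable {M : Type*} [TopologicalSpace M] [ChartedSpace (EuclideanHalfSpace 4) M]
  {e : OpenPartialHomeomorph M (EuclideanHalfSpace 4)} {y : Coord 4}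
  (he : e ∈ IsManifold.maximalAtlas (𝓡∂ 4) ∞ M)
include he

lemma contMDiffOn_pt : ContMDiffOn 𝓘(ℝ, Coord 4) (𝓡∂ 4) ∞ (e.extend (𝓡∂ 4)).symm (dom e) := by
  have h := contMDiffOn_extend_symm he
  rwa [← OpenPartialHomeomorph.extend_target'] at h

lemma contDiffOn_comp_pt {w : M → ℝ} (hw : ContMDiff (𝓡∂ 4) 𝓘(ℝ) ∞ w) :
    ContDiffOn ℝ ∞ (fun z => w (pt e z)) (dom e) :=
  contMDiffOn_iff_contDiffOn.1 (hw.comp_contMDiffOn (contMDiffOn_pt he))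

/-- The derivative of the chart is a left inverse of the derivative of its inverse, so it carries
the coordinate vectors back to the standard basis. -/
lemma linearIndependent_coordVec (hy : y ∈ dom e) : LinearIndependent ℝ (coordVec e y) := by
  have hsrc : pt e y ∈ e.source := by
    have := (e.extend (𝓡∂ 4)).map_target hy
    rwa [OpenPartialHomeomorph.extend_source] at this
  have h1 := (((contMDiffOn_pt he) y hy).mdifferentiableWithinAt (by simp)).hasMFDerivWithinAt
  have h2 := ((e.contMDiffAt_extend he hsrc).mdifferentiableAt (by simp)).hasMFDerivAt
  have h3 := h2.comp_hasMFDerivWithinAt y h1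
  have h4 : HasMFDerivWithinAt 𝓘(ℝ, Coord 4) 𝓘(ℝ, Coord 4)
      ((e.extend (𝓡∂ 4)) ∘ (e.extend (𝓡∂ 4)).symm) (dom e) y
      (ContinuousLinearMap.id ℝ (TangentSpace 𝓘(ℝ, Coord 4) y)) :=
    (hasMFDerivWithinAt_id (dom e) y).congr_of_eventuallyEq
      (Filter.eventually_of_mem self_mem_nhdsWithin
        fun z hz => (e.extend (𝓡∂ 4)).right_inv hz) ((e.extend (𝓡∂ 4)).right_inv hy)
  -- Uniqueness of derivatives within the half-space domain makes the comparison valid at boundary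
  -- points too.
  have h5 := (regularDomain_dom.uniqueDiffOn y hy).uniqueMDiffWithinAt.eq h3 h4
  set D := mfderiv (𝓡∂ 4) 𝓘(ℝ, Coord 4) (e.extend (𝓡∂ 4)) (pt e y) with hD
  have h6 : ∀ i, D (coordVec e y i) = EuclideanSpace.single i (1 : ℝ) := fun i =>
    congrArg (fun L : Coord 4 →L[ℝ] Coord 4 => L (EuclideanSpace.single i 1)) h5
  refine LinearIndependent.of_comp D.toLinearMap ?_
  have h7 : (D.toLinearMap ∘ coordVec e y) = fun i => EuclideanSpace.single i (1 : ℝ) :=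
    funext h6
  rw [h7]
  have h8 : (fun i => EuclideanSpace.single i (1 : ℝ))
      = ⇑(EuclideanSpace.basisFun (Fin 4) ℝ).toBasis := by funext i; simp
  rw [h8]
  exact (EuclideanSpace.basisFun (Fin 4) ℝ).toBasis.linearIndependent

/-- The congruence matrix holds the coefficients of the coordinate vectors in an orthonormal basis.
-/
lemma isLorentzMatrix_comp {g : TensorField2 M} (hg : IsLorentzMetricOn univ g)
    (hy : y ∈ dom e) : IsLorentzMatrix (comp e g y) := by
  obtain ⟨b, hb⟩ := hg.signature (pt e y) (mem_univ _)
  have hli := linearIndependent_coordVec he hy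
  have hcard : Fintype.card (Fin 4) = Module.finrank ℝ (TangentSpace (𝓡∂ 4) (pt e y)) := by
    rw [Module.finrank_eq_card_basis b]
  let c := basisOfLinearIndependentOfCardEqFinrank hli hcard
  have hc : ⇑c = coordVec e y := coe_basisOfLinearIndependentOfCardEqFinrank hli hcard
  refine ⟨b.toMatrix c, ?_, fun i j => ?_⟩
  · have := b.invertibleToMatrix c
    exact (Matrix.isUnit_iff_isUnit_det _).1 (isUnit_of_invertible _)
  · have h1 : ∀ k, coordVec e y k = ∑ l, b.toMatrix c l k • b l := fun k => by
      rw [b.sum_toMatrix_smul_self, hc]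
    simp only [comp, Matrix.of_apply]
    rw [h1 i, h1 j]
    exact bilin_minkowski_frame (g (pt e y)) b hb _ _

lemma isMetricOn_comp {g : TensorField2 M} (hg : IsLorentzMetricOn univ g) :
    IsMetricOn (dom e) (comp e g) where
  smooth i j := by simpa using hg.smooth e he i j
  symm y hy := by
    ext i j
    exact (isLorentzMatrix_comp he hg hy).comm j i
  det_ne_zero y hy := (isLorentzMatrix_comp he hg hy).det_ne_zero

/-- The level sets of a function with timelike gradient are spacelike. -/
lemma posDef_indMetric {g : TensorField2 M} (hg : IsLorentzMetricOn univ g)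
    {w : M → ℝ} (hw : ContMDiff (𝓡∂ 4) 𝓘(ℝ) ∞ w)
    (hgrad : ∀ y ∈ dom e, w (pt e y) = 0 → tr (comp e g y) (fun a b =>
      pd (dom e) a (fun z => w (pt e z)) y * pd (dom e) b (fun z => w (pt e z)) y) = -1)
    {V : Set (Coord 3)} {φ : Coord 3 → Coord 4}
    (hφ : IsLocalParam (dom e) (fun z => w (pt e z)) V φ) {u : Coord 3} (hu : u ∈ V) :
    (indMetric (comp e g) V φ u).PosDef := by
  have hV := RegularDomain.of_isOpen hφ.isOpen
  have hm : MapsTo φ V (dom e) := fun u hu => (hφ.mapsTo u hu).1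
  have hL := isLorentzMatrix_comp he hg (hm hu)
  -- The function is constant along φ, so its differential annihilates the tangent vectors.
  have hker : ∀ i, ev1 (fun a => pd (dom e) a (fun z => w (pt e z)) (φ u)) (tang V φ u i) = 0 :=
    fun i => by
      rw [ev1_pd_tang hV hφ.contDiffOn hm hu i (contDiffOn_comp_pt he hw),
        pd_congr (f' := fun _ => 0) (fun v hv => (hφ.mapsTo v hv).2) hu, pd_const]
  refine Matrix.PosDef.of_dotProduct_mulVec_pos ?_ fun c hc => ?_
  · ext i j
    exact ev2_comm_of_symm hL.comm _ _
  set X : Fin 4 → ℝ := fun a => ∑ i, c i * tang V φ u i a with hXdef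
  have h1 : star c ⬝ᵥ (indMetric (comp e g) V φ u).mulVec c = ev2 (comp e g (φ u)) X X := by
    simp only [hXdef, ev2, ev1_vec_sum, ev1_vec_mul, ev1_sum, ev1_mul, dotProduct, Matrix.mulVec,
      indMetric, Matrix.of_apply, Finset.mul_sum, Pi.star_apply, star_trivial]
    exact Finset.sum_congr rfl fun i _ => Finset.sum_congr rfl fun j _ => by ring
  rw [h1]
  refine hL.pos_of_covector (t := fun a => pd (dom e) a (fun z => w (pt e z)) (φ u)) ?_ ?_ ?_
  · rw [hgrad _ (hm hu) (hφ.mapsTo u hu).2]; norm_num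
  · simp only [hXdef, ev1_vec_sum, ev1_vec_mul, hker, mul_zero, Finset.sum_const_zero]
  · intro hX
    refine hc (funext fun i => ?_)
    have h2 : ∑ i, c i • tang V φ u i = 0 := by
      rw [← hX]
      funext a
      simp [hXdef]
    exact Fintype.linearIndependent_iff.1 (hφ.immersion u hu) c h2 i

end Manifold

end BachConstraint

end

/-! ### Assembly of the theorem. -/

open BachConstraint in
theorem mainTheorem3 {M : Type*} [TopologicalSpace M] [ChartedSpace (EuclideanHalfSpace 4) M]
    [IsManifold (𝓡∂ 4) ∞ M]
    (gbar gcheck S Tbar : TensorField2 M) (w : M → ℝ) (Λ v : ℝ) (hΛ : 0 < Λ) (hv : 0 ≤ v)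
    (hext : IsConformalExtension gbar gcheck w)
    (hS : IsSmoothOn univ S) (hT : IsSmoothOn univ Tbar)
    (hfield : ConformalFieldEquations gbar S Tbar w Λ v)
    (hzero : ∀ p ∈ (𝓡∂ 4).boundary M, w p = 0)
    (hgrad : ∀ e ∈ IsManifold.maximalAtlas (𝓡∂ 4) ∞ M, ∀ y ∈ dom e, w (pt e y) = 0 →
      tr (comp e gbar y) (fun a b =>
        pd (dom e) a (fun z => w (pt e z)) y * pd (dom e) b (fun z => w (pt e z)) y) = -1) :
    ∀ e ∈ IsManifold.maximalAtlas (𝓡∂ 4) ∞ M,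
    ∀ (V : Set (Coord 3)) (φ : Coord 3 → Coord 4),
      IsLocalParam (dom e) (fun z => w (pt e z)) V φ →
      -- the hypersurface is spacelike
      (∀ u ∈ V, (indMetric (comp e gbar) V φ u).PosDef) ∧
      -- the constraints, for either choice of the unit normal
      ∀ N : Coord 3 → Fin 4 → ℝ, IsUnitNormal (comp e gbar) V φ N →
        let s := dom e
        let g := comp e gbar
        let h := indMetric g V φ
        let K := extrinsic s g V φ N
        let E := electric s g V φ N
        ∀ u ∈ V,
          (ev2 (comp e S (φ u)) (N u) (N u) =
            div1 V h (div2 V h E) u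
            - div1 V h (fun x c => contr (h x) (K x) (weylTTTN s g V φ N x c)) u
            + contr (h u) (E u) (schoutenTT s g V φ u)
            + contr (h u) (K u) (cottonTNT s g V φ N u)) ∧
          ∀ a : Fin 3,
            ev2 (comp e S (φ u)) (tang V φ u a) (N u) =
              - div2 V h (cottonTNT s g V φ N) u a
              - ∑ c, ∑ d, (h u)⁻¹ c d * div2 V h E u c * K u a d
              + contr (h u) (K u) (fun b c =>
                  ∑ d, ∑ f, (h u)⁻¹ d f * K u a f * weylNTTT s g V φ N u b c d)
              + contr (h u) (schoutenTT s g V φ u) (fun c d =>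
                  ev4 (weyl s g (φ u)) (tang V φ u d) (tang V φ u a) (tang V φ u c) (N u))
              + ∑ b, ∑ d, (h u)⁻¹ b d * schoutenNT s g V φ N u b * E u a d := by
  intro e he V φ hφ
  have hpos : ∀ u ∈ V, (indMetric (comp e gbar) V φ u).PosDef := fun u hu =>
    posDef_indMetric he hext.lorentz_bar hext.smooth (hgrad e he) hφ hu
  refine ⟨hpos, fun N hN => ?_⟩
  intro s g h K E u hu
  have H : IsSpacelike s g V φ N :=
    { regular := regularDomain_dom
      metric := isMetricOn_comp he hext.lorentz_bar
      regular_param := RegularDomain.of_isOpen hφ.isOpen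
      contDiffOn := hφ.contDiffOn
      mapsTo := fun u hu => (hφ.mapsTo u hu).1
      unitNormal := hN
      det_ne_zero := fun u hu => (hpos u hu).det_pos.ne' }
  -- The Bach equation holds up to the boundary, so S may be replaced by B at points of the
  -- hypersurface.
  have hB : ∀ X Y, ev2 (comp e S (φ u)) X Y = ev2 (bach s g (φ u)) X Y := fun X Y => by
    have h1 : bach s g (φ u) = fun a b => comp e S (φ u) a b := by
      funext a b
      exact hfield.bach_eq e he (φ u) (hφ.mapsTo u hu).1 a b
    rw [h1]
  exact ⟨(hB _ _).trans (H.bach_normal_normal hu),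
    fun a => (hB _ _).trans (H.bach_tang_normal hu a)⟩
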